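/- Let $R$ be a commutative Noetherian ring and $D(R)$ the (unbounded) derived category of $R$-modules, written cohomologically. For $X\in D(R)$ let $\operatorname{supp}(X)=\{\mathfrak p\in\operatorname{Spec}R : X\otimes^{\mathrm L}_R\kappa(\mathfrak p)\neq 0\}$, and for $W\subseteq\operatorname{Spec}R$ let $\mathcal L_W=\{X\in D(R):\operatorname{supp}(X)\subseteq W\}$, a localizing subcategory. A localizing subcategory $\mathcal L$ of $D(R)$ is called smashing if $\mathcal L=\mathcal L_W$ for some specialization-closed $W$. For a complex $X$ and $n\in\mathbb Z$ let $\sigma_{\le n}X$ and $\sigma_{>n}X$ be the canonical (cohomology-preserving) truncations, and let $\operatorname{Ext}^i_R(X,Y)=\operatorname{Hom}_{D(R)}(X,Y[i])\cong H^i(\mathrm{RHom}_R(X,Y))$. For an $R$-module $M$ let $\Gamma_W(M)=\{x\in M:\operatorname{Supp}(Rx)\subseteq W\}$, applied degreewise to complexes. (1) Let $\mathcal L$ be a smashing subcategory of $D(R)$, and let $\gamma\colon D(R)\to\mathcal L$ be a right adjoint of the inclusion $\mathcal L\hookrightarrow D(R)$. Let $X$ be a complex of $R$-modules, $n\in\mathbb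 Z$, and $I$ a bounded complex of injective $R$-modules with $I^i=0$ for all $i>n$, and assume that $\sigma_{\le -1}X\in\mathcal L$. Then the counit $\gamma I\to I$ induces an isomorphism $$\sigma_{>n}\mathrm{RHom}_R(X,\gamma I)\;\cong\;\sigma_{>n}\mathrm{RHom}_R(X,I)$$ in $D(R)$, and $R$-linear isomorphisms $\operatorname{Ext}^i_R(X,\gamma I)\cong\operatorname{Ext}^i_R(X,I)$ for all $i>n$. (2) Let $W\subseteq\operatorname{Spec}R$ be specialization-closed. Then, for every complex $X$, one has $\sigma_{\le-1}X\in\mathcal L_W$ if and only if $\operatorname{Supp}H^i(X)\subseteq W$ for all $i<0$. If $\gamma$ is a right adjoint of $\mathcal L_W\hookrightarrow D(R)$ and $I$ is a bounded complex of injective $R$-modules, then there is an isomorphism $\Gamma_W I\cong\gamma I$ in $D(R)$ that identifies the inclusion $\Gamma_W I\to I$ with the counit $\gamma I\to I$. Moreover, if $I$ is a bounded complex of injective $R$-modules with $I^i=0$ for all $i>n$, and $X$ is a complex with $\operatorname{Supp}H^i(X)\subseteq W$ for all $i<0$, then the inclusion $\Gamma_W I\to I$ induces isomorphisms $$\operatorname{Ext}^i_R(X,\Gamma_W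 I)\;\cong\;\operatorname{Ext}^i_R(X,I)\qquad\text{for all } i>n.$$ -/

import Mathlib

universe w u

open CategoryTheory CategoryTheory.Limits

noncomputable section

namespace ARPrinciple

variable {R : Type u} [CommRing R]

/-! ### Derived tensor product with a module, small support, smashing subcategories -/

/-- A chosen projective resolution of the module `M`, as a complex in nonpositive degrees. -/
def projRes (M : ModuleCat.{u} R) : CochainComplex (ModuleCat.{u} R) ℤ :=
  (projectiveResolution M).cochainComplex

/-- The derived tensor product `X ⊗ᴸ M` of a complex `X` with a module `M`: the total tensor
product of `X` with a projective resolution of `M`. -/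
def derivedTensor [HasDerivedCategory.{w} (ModuleCat.{u} R)]
    (X : CochainComplex (ModuleCat.{u} R) ℤ) (M : ModuleCat.{u} R) :
    DerivedCategory (ModuleCat.{u} R) :=
  DerivedCategory.Q.obj (HomologicalComplex.tensorObj X (projRes M))

/-- The residue field `κ(p)` as an `R`-module. -/
abbrev kappa (p : PrimeSpectrum R) : ModuleCat.{u} R :=
  ModuleCat.of R p.asIdeal.ResidueField

/-- The small support `{p | X ⊗ᴸ κ(p) ≠ 0}` of an object `X` of `D(R)`
(computed on a complex representing `X`). -/
def smallSupport [HasDerivedCategory.{w} (ModuleCat.{u} R)]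
    (X : DerivedCategory (ModuleCat.{u} R)) : Set (PrimeSpectrum R) :=
  {p | ¬ IsZero (derivedTensor.{w} (DerivedCategory.Q.objPreimage X) (kappa p))}

/-- The full subcategory `L_W` of `D(R)` of the objects with small support in `W`. -/
def subcategoryOfSupport [HasDerivedCategory.{w} (ModuleCat.{u} R)]
    (W : Set (PrimeSpectrum R)) : ObjectProperty (DerivedCategory (ModuleCat.{u} R)) :=
  fun X => smallSupport X ⊆ W

/-- A (strictly full) subcategory of `D(R)` is smashing if it is `L_W` for some
specialization-closed `W`. (Every `L_W` is a localizing subcategory, so this need not be required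
separately.) -/
def IsSmashing [HasDerivedCategory.{w} (ModuleCat.{u} R)]
    (L : ObjectProperty (DerivedCategory (ModuleCat.{u} R))) : Prop :=
  ∃ W : Set (PrimeSpectrum R), StableUnderSpecialization W ∧ L = subcategoryOfSupport W

/-! ### Sections with support in `W` -/

lemma mem_support_span_singleton_iff {M : Type*} [AddCommGroup M] [Module R M] (x : M)
    (p : PrimeSpectrum R) :
    p ∈ Module.support R (Submodule.span R {x}) ↔ ∀ r : R, r • x = 0 → r ∈ p.asIdeal := by
  rw [Module.mem_support_iff']
  constructor
  · rintro ⟨⟨m, hm⟩, h⟩ r hr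
    obtain ⟨a, rfl⟩ := Submodule.mem_span_singleton.1 hm
    by_contra hrp
    apply h r hrp
    ext
    simp [smul_comm r a, hr]
  · intro h
    refine ⟨⟨x, Submodule.mem_span_singleton_self x⟩, fun r hr h0 => hr (h r ?_)⟩
    simpa using congrArg Subtype.val h0

/-- `Γ_W(M) = {x ∈ M | Supp (R x) ⊆ W}`. -/
def gammaSubmodule (W : Set (PrimeSpectrum R)) (M : Type*) [AddCommGroup M] [Module R M] :
    Submodule R M where
  carrier := {x | Module.support R (Submodule.span R {x}) ⊆ W}
  zero_mem' := by
    intro p hp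
    rw [mem_support_span_singleton_iff] at hp
    exact absurd (p.asIdeal.eq_top_iff_one.2 (hp 1 (by simp))) p.isPrime.ne_top
  add_mem' := by
    intro x y hx hy p hp
    rw [mem_support_span_singleton_iff] at hp
    by_contra hpW
    have hx' : ¬ ∀ r : R, r • x = 0 → r ∈ p.asIdeal := fun h =>
      hpW (hx ((mem_support_span_singleton_iff x p).2 h))
    have hy' : ¬ ∀ r : R, r • y = 0 → r ∈ p.asIdeal := fun h =>
      hpW (hy ((mem_support_span_singleton_iff y p).2 h))
    push Not at hx' hy'
    obtain ⟨a, ha, ha'⟩ := hx'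
    obtain ⟨b, hb, hb'⟩ := hy'
    have h := hp (a * b) (by rw [smul_add, mul_comm a b, mul_smul, ha, mul_comm b a, mul_smul, hb]
                             simp)
    exact (p.isPrime.mem_or_mem h).elim ha' hb'
  smul_mem' := by
    intro c x hx p hp
    rw [mem_support_span_singleton_iff] at hp
    exact hx ((mem_support_span_singleton_iff x p).2
      fun r hr => hp r (by rw [smul_comm, hr, smul_zero]))

lemma map_mem_gammaSubmodule (W : Set (PrimeSpectrum R)) {M N : Type*} [AddCommGroup M]
    [Module R M] [AddCommGroup N] [Module R N] (f : M →ₗ[R] N) (x : M)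
    (hx : x ∈ gammaSubmodule W M) : f x ∈ gammaSubmodule W N := by
  intro p hp
  rw [mem_support_span_singleton_iff] at hp
  exact hx ((mem_support_span_singleton_iff x p).2
    fun r hr => hp r (by rw [← map_smul, hr, map_zero]))

/-- The functor `Γ_W` on modules. -/
def gammaFunctor (W : Set (PrimeSpectrum R)) : ModuleCat.{u} R ⥤ ModuleCat.{u} R where
  obj M := ModuleCat.of R (gammaSubmodule W M)
  map f := ModuleCat.ofHom (f.hom.restrict (map_mem_gammaSubmodule W f.hom))

/-- The inclusion `Γ_W(M) ⟶ M`. -/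
def gammaInclusion (W : Set (PrimeSpectrum R)) :
    gammaFunctor W ⟶ 𝟭 (ModuleCat.{u} R) where
  app M := ModuleCat.ofHom (gammaSubmodule W M).subtype

instance (W : Set (PrimeSpectrum R)) :
    (gammaFunctor W : ModuleCat.{u} R ⥤ ModuleCat.{u} R).Additive where

/-- The complex `Γ_W(I)`, formed degreewise. When `I` is a bounded complex of injectives it
represents `RΓ_W(I)`. -/
def gammaComplex (W : Set (PrimeSpectrum R)) (I : CochainComplex (ModuleCat.{u} R) ℤ) :
    CochainComplex (ModuleCat.{u} R) ℤ :=
  ((gammaFunctor W).mapHomologicalComplex _).obj I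

/-- The inclusion of the subcomplex `Γ_W(I) ⟶ I`. -/
def gammaComplexι (W : Set (PrimeSpectrum R)) (I : CochainComplex (ModuleCat.{u} R) ℤ) :
    gammaComplex W I ⟶ I where
  f i := (gammaInclusion W).app (I.X i)
  comm' i j _ := ((gammaInclusion W).naturality (I.d i j)).symm

/-! ### Ext and derived Hom -/

/-- `Extⁱ(X, Y) = Hom_{D(R)}(X, Y[i])`. -/
abbrev DExt [HasDerivedCategory.{w} (ModuleCat.{u} R)]
    (X Y : DerivedCategory (ModuleCat.{u} R)) (i : ℤ) : Type w :=
  X ⟶ (shiftFunctor (DerivedCategory (ModuleCat.{u} R)) i).obj Y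

/-- The `R`-linear map `Extⁱ(X, Y) → Extⁱ(X, Z)` induced by `φ : Y ⟶ Z`. -/
def extMap [HasDerivedCategory.{w} (ModuleCat.{u} R)]
    (X : DerivedCategory (ModuleCat.{u} R)) {Y Z : DerivedCategory (ModuleCat.{u} R)}
    (φ : Y ⟶ Z) (i : ℤ) : DExt X Y i →ₗ[R] DExt X Z i :=
  Linear.rightComp R X ((shiftFunctor (DerivedCategory (ModuleCat.{u} R)) i).map φ)

/-- The complex of `R`-modules `Hom•(K, L)`. -/
def homComplex (K L : CochainComplex (ModuleCat.{u} R) ℤ) :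
    CochainComplex (ModuleCat.{u} R) ℤ where
  X i := ModuleCat.of R (CochainComplex.HomComplex.Cochain K L i)
  d i j := ModuleCat.ofHom (CochainComplex.HomComplex.δ_hom R K L i j)
  shape i j hij := by
    ext z
    simp [CochainComplex.HomComplex.δ_shape _ _ hij]
  d_comp_d' i j k _ _ := by
    ext z
    simp [CochainComplex.HomComplex.δ_δ]

/-- The morphism `Hom•(K, L) ⟶ Hom•(K, L')` induced by `f : L ⟶ L'`. -/
def homComplexMap (K : CochainComplex (ModuleCat.{u} R) ℤ)
    {L L' : CochainComplex (ModuleCat.{u} R) ℤ} (f : L ⟶ L') :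
    homComplex K L ⟶ homComplex K L' where
  f i := ModuleCat.ofHom
    { toFun := fun z => z.comp (CochainComplex.HomComplex.Cochain.ofHom f) (add_zero i)
      map_add' := fun z z' => by simp
      map_smul' := fun r z => by simp }
  comm' i j _ := by
    ext z
    exact CochainComplex.HomComplex.δ_comp_ofHom z f j

/-- A K-injective resolution of an object `Y` of `D(R)`. -/
structure KInjectiveResolution [HasDerivedCategory.{w} (ModuleCat.{u} R)]
    (Y : DerivedCategory (ModuleCat.{u} R)) where
  /-- the K-injective complex -/
  complex : CochainComplex (ModuleCat.{u} R) ℤ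
  isKInjective : complex.IsKInjective
  /-- the isomorphism in the derived category -/
  iso : DerivedCategory.Q.obj complex ≅ Y

/-- The morphism `φ : Y ⟶ Z` of `D(R)` induces an isomorphism
`σ_{>n} RHom(X, Y) ≅ σ_{>n} RHom(X, Z)` in `D(R)`. Here `RHom(X, -)` is computed by `Hom•(X, -)` on
K-injective resolutions, and `σ_{>n}` is the canonical truncation in degrees `≥ n + 1`.
We require that resolutions of `Y` and `Z` and a lift of `φ` exist, and that the induced morphism
is an isomorphism whichever ones are used. -/
structure InducesIsoTruncRHom [HasDerivedCategory.{w} (ModuleCat.{u} R)]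
    (X : CochainComplex (ModuleCat.{u} R) ℤ) {Y Z : DerivedCategory (ModuleCat.{u} R)}
    (φ : Y ⟶ Z) (n : ℤ) : Prop where
  exists_lift : ∃ (J : KInjectiveResolution Y) (J' : KInjectiveResolution Z)
    (f : J.complex ⟶ J'.complex), DerivedCategory.Q.map f ≫ J'.iso.hom = J.iso.hom ≫ φ
  isIso : ∀ (J : KInjectiveResolution Y) (J' : KInjectiveResolution Z)
    (f : J.complex ⟶ J'.complex), DerivedCategory.Q.map f ≫ J'.iso.hom = J.iso.hom ≫ φ →
      IsIso (DerivedCategory.Q.map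
        (CochainComplex.truncGEMap (homComplexMap X f) (n + 1)))

/-- `I` is a bounded complex of injective modules with `Iⁱ = 0` for `i > n`. -/
structure IsBoundedInjective (I : CochainComplex (ModuleCat.{u} R) ℤ) (n : ℤ) : Prop where
  injective : ∀ i, Injective (I.X i)
  isZero_below : ∃ m : ℤ, ∀ i < m, IsZero (I.X i)
  isZero_above : ∀ i > n, IsZero (I.X i)

/-- The big support of `Hⁱ(X)` is contained in `W` for all `i < 0`. -/
def NegCohomologySupportedIn (X : CochainComplex (ModuleCat.{u} R) ℤ)
    (W : Set (PrimeSpectrum R)) : Prop :=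
  ∀ i < 0, Module.support R (X.homology i) ⊆ W

end ARPrinciple

end

/-!
Fix a Noetherian ring `R` and a specialization-closed set `W` of primes.

*The objects of `L_W` are the complexes whose cohomology is supported in `W`*
(`forall_torKernel_kappa_iff`, `subcategoryOfSupport_iff`). For a complex `Y`, a submonoid `S` of
`R` and a module `M`, consider the condition `S⁻¹(Y ⊗ᴸ M) = 0` (`torKernel`). For fixed `S` and
`Y` it has the two out of three property in short exact sequences, because `K ↦ S⁻¹H⁰(Y ⊗ K)` is a
homological functor on the homotopy category and short exact sequences lift to triangles of
projective resolutions. If `p ∉ W` and the cohomology of `Y` is supported in `W`, then `Y` is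
acyclic at `p`, hence so is `Y ⊗ᴸ κ(p)`, on which every `r ∉ p` is invertible; so `Y ⊗ᴸ κ(p) = 0`.
Conversely, assume `Y ⊗ᴸ κ(p) = 0` for all `p ∉ W`, and let `q ∉ W`. Noetherian induction on the
ideal `I` shows that `Y ⊗ᴸ R ⧸ I` is acyclic at `q`: a devissage reduces this to a prime
`I = p ⊆ q`, which is not in `W`, and then `Y ⊗ᴸ R ⧸ p` is acyclic at `p`, while by
induction every `r ∉ p` acts bijectively on the homology of `Y ⊗ᴸ R ⧸ p` at `q`. The case `I = 0`
says that the cohomology of `Y` vanishes at `q`.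

*The inclusion `Γ_W(I) ⟶ I` induces isomorphisms on `Extⁱ(X, -)`* if `I` is a bounded complex of
injectives in degrees `≤ n` and `Hᵐ(X)` is supported in `W` for all `m ≤ n - i`
(`cohomologyBijective_gammaComplexι`). By Artin–Rees, `Γ_W` preserves injective modules
(`injective_gammaSubmodule`), so that `Γ_W(I)` is a degreewise direct summand of `I`, whose
complements contain no nonzero element with support in `W`. Hence a map from `Xᵐ` to such a
complement which kills the boundaries kills all cocycles, and extends to `Xᵐ⁺¹`
(`exists_isGammaValued_sub`). By induction on `m`, a cocycle of `Hom•(X, I)` is cohomologous to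
one with values in `Γ_W(I)`, and likewise for homotopies.

For `i > n` the condition on `X` only involves negative degrees, and follows from
`σ_{≤ -1} X ∈ L_W`. For `X ∈ L_W` it holds for every `i`. The case `i = 0` says that
`Γ_W(I) ⟶ I` has the universal property of the counit of a right adjoint of the inclusion of `L_W`
(`exists_iso_gamma`), so both parts of the theorem concern the same morphism. For K-injective
complexes, bijectivity on `Extⁱ(X, -)` and on `Hⁱ(Hom•(X, -))` are equivalent
(`bijective_extMap_iff`), which gives the isomorphism of truncated derived Hom complexes for
arbitrary K-injective resolutions.
-/

noncomputable section

namespace ARPrinciple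

variable {R : Type u} [CommRing R]

/-! ### Localization of modules -/

section

open TensorProduct

/-- The localization functor `M ↦ S⁻¹M`, with `S⁻¹M` regarded as an `R`-module. -/
def locFunctor (S : Submonoid R) : ModuleCat.{u} R ⥤ ModuleCat.{u} R where
  obj M := ModuleCat.of R (LocalizedModule S M)
  map {M N} f := ModuleCat.ofHom (IsLocalizedModule.map S (LocalizedModule.mkLinearMap S M)
    (LocalizedModule.mkLinearMap S N) f.hom)
  map_id M := by
    ext x
    simp
  map_comp {X Y Z} f g := by
    ext
    simp [IsLocalizedModule.map_comp' S _ (LocalizedModule.mkLinearMap S Y)]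

instance (S : Submonoid R) : (locFunctor S : ModuleCat.{u} R ⥤ ModuleCat.{u} R).Additive where
  map_add {M N f g} := by
    simp only [locFunctor, map_add, ModuleCat.hom_add]
    rfl

lemma locFunctor_map_exact (S : Submonoid R) (T : ShortComplex (ModuleCat.{u} R))
    (h : T.Exact) : (T.map (locFunctor S)).Exact := by
  rw [CategoryTheory.ShortComplex.ShortExact.moduleCat_exact_iff_function_exact] at h ⊢
  exact IsLocalizedModule.map_exact S (LocalizedModule.mkLinearMap S T.X₁)
    (LocalizedModule.mkLinearMap S T.X₂) (LocalizedModule.mkLinearMap S T.X₃) _ _ h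

instance (S : Submonoid R) :
    PreservesFiniteLimits (locFunctor S : ModuleCat.{u} R ⥤ ModuleCat.{u} R) :=
  have h : PreservesFiniteLimits (locFunctor S : ModuleCat.{u} R ⥤ ModuleCat.{u} R) ∧
      PreservesFiniteColimits (locFunctor S : ModuleCat.{u} R ⥤ ModuleCat.{u} R) :=
    ((Functor.exact_tfae (locFunctor S)).out 1 3).mp (locFunctor_map_exact S)
  h.1

instance (S : Submonoid R) :
    PreservesFiniteColimits (locFunctor S : ModuleCat.{u} R ⥤ ModuleCat.{u} R) :=
  have h : PreservesFiniteLimits (locFunctor S : ModuleCat.{u} R ⥤ ModuleCat.{u} R) ∧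
      PreservesFiniteColimits (locFunctor S : ModuleCat.{u} R ⥤ ModuleCat.{u} R) :=
    ((Functor.exact_tfae (locFunctor S)).out 1 3).mp (locFunctor_map_exact S)
  h.2

/-- The natural map `M ⟶ S⁻¹M`. -/
def toLoc (S : Submonoid R) : 𝟭 (ModuleCat.{u} R) ⟶ locFunctor S where
  app M := ModuleCat.ofHom (LocalizedModule.mkLinearMap S M)
  naturality M N f := by
    ext x
    exact (IsLocalizedModule.map_apply S (LocalizedModule.mkLinearMap S M)
      (LocalizedModule.mkLinearMap S N) f.hom x).symm

lemma isZero_locFunctor_iff (S : Submonoid R) (M : ModuleCat.{u} R) :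
    IsZero ((locFunctor S).obj M) ↔ ∀ m : M, ∃ s ∈ S, s • m = 0 := by
  rw [ModuleCat.isZero_iff_subsingleton]
  exact LocalizedModule.subsingleton_iff

/-! ### The total tensor product of complexes -/

/-- The functor `Y ⊗ -` (total tensor product) on complexes. -/
abbrev tensorLeft (Y : CochainComplex (ModuleCat.{u} R) ℤ) :
    CochainComplex (ModuleCat.{u} R) ℤ ⥤ CochainComplex (ModuleCat.{u} R) ℤ :=
  (MonoidalCategory.curriedTensor (ModuleCat.{u} R)).map₂CochainComplex.obj Y

/-- The inclusion of the summand `Yᵃ ⊗ Kᵇ` in degree `n = a + b` of `Y ⊗ K`. -/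
def tensorι (Y K : CochainComplex (ModuleCat.{u} R) ℤ) (a b n : ℤ) (h : a + b = n) :
    (Y.X a ⊗[R] K.X b) →ₗ[R] ((tensorLeft Y).obj K).X n :=
  (HomologicalComplex.ιTensorObj Y K a b n h).hom

open Classical in
/-- The projection of the degree `n` part of `Y ⊗ K` onto the summand `Yᵃ ⊗ Kᵇ`; it is zero unless
`a + b = n`. -/
def tensorπ (Y K : CochainComplex (ModuleCat.{u} R) ℤ) (a b n : ℤ) :
    ((tensorLeft Y).obj K).X n →ₗ[R] (Y.X a ⊗[R] K.X b) :=
  (HomologicalComplex.mapBifunctorDesc (A := ModuleCat.of R (Y.X a ⊗[R] K.X b))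
    (F := MonoidalCategory.curriedTensor (ModuleCat.{u} R))
    (fun i j _ => if h : i = a ∧ j = b then eqToHom (by rw [h.1, h.2]; rfl) else 0)).hom

variable {Y K L : CochainComplex (ModuleCat.{u} R) ℤ}

lemma tensorπ_ι (a b n : ℤ) (h : a + b = n) (t : Y.X a ⊗[R] K.X b) :
    tensorπ Y K a b n (tensorι Y K a b n h t) = t := by
  have := HomologicalComplex.ι_mapBifunctorDesc (A := ModuleCat.of R (Y.X a ⊗[R] K.X b))
    (F := MonoidalCategory.curriedTensor (ModuleCat.{u} R)) (c := .up ℤ) (j := n)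
    (fun i j _ => if h : i = a ∧ j = b then eqToHom (by rw [h.1, h.2]; rfl) else 0) a b h
  refine (congrArg (fun f => f.hom t) this).trans ?_
  simp

lemma tensorπ_ι_ne (a b a' b' n : ℤ) (h : a' + b' = n) (hb : b' ≠ b) (t : Y.X a' ⊗[R] K.X b') :
    tensorπ Y K a b n (tensorι Y K a' b' n h t) = 0 := by
  have := HomologicalComplex.ι_mapBifunctorDesc (A := ModuleCat.of R (Y.X a ⊗[R] K.X b))
    (F := MonoidalCategory.curriedTensor (ModuleCat.{u} R)) (c := .up ℤ) (j := n)
    (fun i j _ => if h : i = a ∧ j = b then eqToHom (by rw [h.1, h.2]; rfl) else 0) a' b' h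
  refine (congrArg (fun f => f.hom t) this).trans ?_
  simp [hb]

/-- Linear maps out of a degree of `Y ⊗ K` agree when they agree on the elements `y ⊗ k`. -/
lemma tensor_linearMap_ext {M : Type u} [AddCommGroup M] [Module R M] {n : ℤ}
    {f g : ((tensorLeft Y).obj K).X n →ₗ[R] M}
    (h : ∀ a b (h : a + b = n) (y : Y.X a) (k : K.X b),
      f (tensorι Y K a b n h (y ⊗ₜ k)) = g (tensorι Y K a b n h (y ⊗ₜ k))) : f = g := by
  have : ModuleCat.ofHom f = ModuleCat.ofHom g := by
    apply HomologicalComplex.mapBifunctor.hom_ext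
    intro a b hab
    ext : 1
    exact TensorProduct.ext' (h a b hab)
  exact congrArg ModuleCat.Hom.hom this

lemma tensor_d_ι (a b n n' a' b' : ℤ) (h : a + b = n) (hn : n + 1 = n') (ha : a + 1 = a')
    (hb : b + 1 = b') (t : Y.X a ⊗[R] K.X b) :
    (((tensorLeft Y).obj K).d n n').hom (tensorι Y K a b n h t) =
      tensorι Y K a' b n' (by omega) ((Y.d a a').hom.rTensor _ t) +
      a.negOnePow • tensorι Y K a b' n' (by omega) ((K.d b b').hom.lTensor _ t) := by
  have h1 := HomologicalComplex.mapBifunctor.ι_D₁ Y K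
    (MonoidalCategory.curriedTensor (ModuleCat.{u} R)) (.up ℤ) n n' a b h
  have h2 := HomologicalComplex.mapBifunctor.ι_D₂ Y K
    (MonoidalCategory.curriedTensor (ModuleCat.{u} R)) (.up ℤ) n n' a b h
  rw [HomologicalComplex.mapBifunctor.d₁_eq _ _ _ _ (i₁' := a') (by simpa using ha) _ _
    (by simp; omega)] at h1
  rw [HomologicalComplex.mapBifunctor.d₂_eq _ _ _ _ _ (i₂' := b') (by simpa using hb) _
    (by simp; omega)] at h2
  have h1' := congrArg (fun f => f.hom t) h1
  have h2' := congrArg (fun f => f.hom t) h2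
  refine (congrArg₂ (· + ·) h1' h2').trans ?_
  simp only [ModuleCat.hom_smul]
  simp
  rfl

lemma tensor_map_ι (f : K ⟶ L) (a b n : ℤ) (h : a + b = n) (t : Y.X a ⊗[R] K.X b) :
    (((tensorLeft Y).map f).f n).hom (tensorι Y K a b n h t) =
      tensorι Y L a b n h ((f.f b).hom.lTensor _ t) := by
  have := HomologicalComplex.ι_mapBifunctorMap (𝟙 Y) f
    (MonoidalCategory.curriedTensor (ModuleCat.{u} R)) (.up ℤ) a b n h
  refine (congrArg (fun f => f.hom t) this).trans ?_
  simp
  rfl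

lemma tensor_iSup_range (Y K : CochainComplex (ModuleCat.{u} R) ℤ) (n : ℤ) :
    ⨆ b, LinearMap.range (tensorι Y K (n - b) b n (by omega)) = ⊤ := by
  rw [← Submodule.ker_mkQ (⨆ b, LinearMap.range (tensorι Y K (n - b) b n (by omega))),
    LinearMap.ker_eq_top]
  apply tensor_linearMap_ext
  intro a b hab y k
  obtain rfl : a = n - b := by omega
  simp only [Submodule.mkQ_apply, LinearMap.zero_apply, Submodule.Quotient.mk_eq_zero]
  exact Submodule.mem_iSup_of_mem b ⟨_, rfl⟩

open Classical in
/-- An element of `(Y ⊗ K)ⁿ` is the sum of its finitely many nonzero components. -/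
lemma exists_tensor_eq_sum {n : ℤ} (x : ((tensorLeft Y).obj K).X n) :
    ∃ s : Finset ℤ, (∀ b ∉ s, tensorπ Y K (n - b) b n x = 0) ∧
      x = ∑ b ∈ s, tensorι Y K (n - b) b n (by omega) (tensorπ Y K (n - b) b n x) := by
  have hx : x ∈ ⨆ b, LinearMap.range (tensorι Y K (n - b) b n (by omega)) := by
    rw [tensor_iSup_range]; trivial
  refine Submodule.iSup_induction _ (motive := fun x => ∃ s : Finset ℤ,
    (∀ b ∉ s, tensorπ Y K (n - b) b n x = 0) ∧
      x = ∑ b ∈ s, tensorι Y K (n - b) b n (by omega) (tensorπ Y K (n - b) b n x)) hx ?_ ?_ ?_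
  · intro b x hx
    obtain ⟨t, rfl⟩ := hx
    refine ⟨{b}, fun b' hb' => tensorπ_ι_ne _ _ _ _ _ _ (by simpa [eq_comm] using hb') _, ?_⟩
    simp [tensorπ_ι]
  · exact ⟨∅, by simp, by simp⟩
  · intro x y hx hy
    obtain ⟨s, hs, hxs⟩ := hx
    obtain ⟨t, ht, hyt⟩ := hy
    refine ⟨s ∪ t, fun b hb => ?_, ?_⟩
    · simp only [Finset.mem_union, not_or] at hb
      simp [hs b hb.1, ht b hb.2]
    · simp only [map_add, Finset.sum_add_distrib]
      congr 1
      · rw [← Finset.sum_subset Finset.subset_union_left fun b _ hb => by simp [hs b hb]]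
        exact hxs
      · rw [← Finset.sum_subset Finset.subset_union_right fun b _ hb => by simp [ht b hb]]
        exact hyt

lemma tensor_eq_zero {n : ℤ} (x : ((tensorLeft Y).obj K).X n)
    (h : ∀ b, tensorπ Y K (n - b) b n x = 0) : x = 0 := by
  obtain ⟨s, -, hs⟩ := exists_tensor_eq_sum x
  rw [hs]
  simp [h]

lemma tensorπ_d (a₀ a b₀ b n n' : ℤ) (ha : a₀ + 1 = a) (hb : b₀ + 1 = b) (hn : n + 1 = n')
    (h : a + b = n') (x : ((tensorLeft Y).obj K).X n) :
    tensorπ Y K a b n' ((((tensorLeft Y).obj K).d n n').hom x) =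
      (Y.d a₀ a).hom.rTensor _ (tensorπ Y K a₀ b n x) +
      a.negOnePow • (K.d b₀ b).hom.lTensor _ (tensorπ Y K a b₀ n x) := by
  have : tensorπ Y K a b n' ∘ₗ (((tensorLeft Y).obj K).d n n').hom =
      (Y.d a₀ a).hom.rTensor _ ∘ₗ tensorπ Y K a₀ b n +
      ((a.negOnePow : ℤ) : R) • ((K.d b₀ b).hom.lTensor _ ∘ₗ tensorπ Y K a b₀ n) := by
    apply tensor_linearMap_ext
    intro i j hij y k
    simp only [LinearMap.comp_apply, LinearMap.add_apply, LinearMap.smul_apply]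
    rw [tensor_d_ι i j n n' (i+1) (j+1) hij hn rfl rfl, map_add, Units.smul_def, map_zsmul,
      Int.cast_smul_eq_zsmul]
    congr 1
    · by_cases hj : j = b
      · obtain rfl : i = a₀ := by omega
        subst hj ha
        rw [tensorπ_ι, tensorπ_ι]
      · rw [tensorπ_ι_ne _ _ _ _ _ _ hj, tensorπ_ι_ne _ _ _ _ _ _ hj, map_zero]
    · by_cases hj : j = b₀
      · obtain rfl : i = a := by omega
        subst hj hb
        rw [tensorπ_ι, tensorπ_ι]
      · rw [tensorπ_ι_ne _ _ _ _ _ _ hj, tensorπ_ι_ne _ _ _ _ _ _ (by omega), map_zero]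
        simp
  rw [Units.smul_def, ← Int.cast_smul_eq_zsmul R]
  exact LinearMap.congr_fun this x

lemma tensorπ_map (f : K ⟶ L) (a b n : ℤ) (h : a + b = n) (x : ((tensorLeft Y).obj K).X n) :
    tensorπ Y L a b n ((((tensorLeft Y).map f).f n).hom x) =
      (f.f b).hom.lTensor _ (tensorπ Y K a b n x) := by
  have : tensorπ Y L a b n ∘ₗ (((tensorLeft Y).map f).f n).hom =
      (f.f b).hom.lTensor _ ∘ₗ tensorπ Y K a b n := by
    apply tensor_linearMap_ext
    intro i j hij y k
    simp only [LinearMap.comp_apply]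
    rw [tensor_map_ι]
    by_cases hj : j = b
    · obtain rfl : i = a := by omega
      subst hj
      rw [tensorπ_ι, tensorπ_ι]
    · rw [tensorπ_ι_ne _ _ _ _ _ _ hj, tensorπ_ι_ne _ _ _ _ _ _ hj, map_zero]
  exact LinearMap.congr_fun this x

end

section

open TensorProduct

instance (Y : CochainComplex (ModuleCat.{u} R) ℤ) : (tensorLeft Y).Additive where
  map_add {K L f g} := by
    ext n : 2
    apply tensor_linearMap_ext
    intro a b hab y k
    refine (tensor_map_ι (f + g) a b n hab _).trans ?_
    rw [HomologicalComplex.add_f_apply, ModuleCat.hom_add, LinearMap.lTensor_add,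
      LinearMap.add_apply, map_add, ← tensor_map_ι, ← tensor_map_ι]
    rfl

instance (Y : CochainComplex (ModuleCat.{u} R) ℤ) : (tensorLeft Y).Linear R where
  map_smul {K L} f r := by
    ext n : 2
    apply tensor_linearMap_ext
    intro a b hab y k
    refine (tensor_map_ι (r • f) a b n hab _).trans ?_
    rw [HomologicalComplex.smul_f_apply, ModuleCat.hom_smul, LinearMap.lTensor_smul,
      LinearMap.smul_apply, map_smul, ← tensor_map_ι]
    rfl

/-- Tensoring with `Y` preserves homotopies. -/
def tensorHomotopy (Y : CochainComplex (ModuleCat.{u} R) ℤ)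
    {K L : CochainComplex (ModuleCat.{u} R) ℤ} {f g : K ⟶ L} (h : Homotopy f g) :
    Homotopy ((tensorLeft Y).map f) ((tensorLeft Y).map g) :=
  HomologicalComplex.mapBifunctorMapHomotopy₂ (𝟙 Y) h
    (MonoidalCategory.curriedTensor (ModuleCat.{u} R)) (.up ℤ)

/-! ### Tensor products that vanish after localization -/

/-- The complex `Z` becomes acyclic after localization at `S`: one has `S⁻¹Hⁱ(Z) = 0` for
all `i`. -/
def IsTorsionAcyclic (S : Submonoid R) (Z : CochainComplex (ModuleCat.{u} R) ℤ) : Prop :=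
  ∀ i, IsZero ((locFunctor S).obj (Z.homology i))

/-- `S⁻¹Hʲ(Z) = 0` if and only if every cocycle of degree `j` has a multiple by some `s ∈ S` that
is a coboundary. -/
lemma isZero_locFunctor_homology_iff (S : Submonoid R) (Z : CochainComplex (ModuleCat.{u} R) ℤ)
    (i j k : ℤ) (hij : i + 1 = j) (hjk : j + 1 = k) :
    IsZero ((locFunctor S).obj (Z.homology j)) ↔
      ∀ z : Z.X j, (Z.d j k).hom z = 0 → ∃ s ∈ S, ∃ w : Z.X i, (Z.d i j).hom w = s • z := by
  have e : Z.homology j ≅ (Z.sc' i j k).moduleCatLeftHomologyData.H :=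
    ShortComplex.homologyMapIso (Z.isoSc' i j k (by simp; omega) (by simp; omega)) ≪≫
      (Z.sc' i j k).moduleCatHomologyIso
  rw [((locFunctor S).mapIso e).isZero_iff, isZero_locFunctor_iff]
  constructor
  · intro h z hz
    obtain ⟨s, hs, h0⟩ := h (Submodule.Quotient.mk ⟨z, hz⟩)
    obtain ⟨w, hw⟩ := (Submodule.Quotient.mk_eq_zero _ (x := s • (⟨z, hz⟩ :
      LinearMap.ker (Z.sc' i j k).g.hom))).1 h0
    exact ⟨s, hs, w, congrArg Subtype.val hw⟩
  · intro h x
    obtain ⟨⟨z, hz⟩, rfl⟩ := Submodule.Quotient.mk_surjective _ x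
    obtain ⟨s, hs, w, hw⟩ := h z hz
    refine ⟨s, hs, (Submodule.Quotient.mk_eq_zero _ (x := s • (⟨z, hz⟩ :
      LinearMap.ker (Z.sc' i j k).g.hom))).2 ⟨w, Subtype.ext hw⟩⟩

lemma isTorsionAcyclic_iff (S : Submonoid R) (Z : CochainComplex (ModuleCat.{u} R) ℤ) :
    IsTorsionAcyclic S Z ↔ ∀ (i j k : ℤ), i + 1 = j → j + 1 = k →
      ∀ z : Z.X j, (Z.d j k).hom z = 0 → ∃ s ∈ S, ∃ w : Z.X i, (Z.d i j).hom w = s • z := by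
  constructor
  · intro h i j k hij hjk
    exact (isZero_locFunctor_homology_iff S Z i j k hij hjk).1 (h j)
  · intro h j
    exact (isZero_locFunctor_homology_iff S Z (j - 1) j (j + 1) (by omega) rfl).2
      (h _ _ _ (by omega) rfl)

/-- Tensoring with a flat module preserves exactness up to `S`-torsion. -/
lemma rTensor_exact_up_to {S : Submonoid R} {A B C F : Type u} [AddCommGroup A] [AddCommGroup B]
    [AddCommGroup C] [AddCommGroup F] [Module R A] [Module R B] [Module R C] [Module R F]
    [Module.Flat R F] (f : A →ₗ[R] B) (g : B →ₗ[R] C)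
    (h : ∀ z, g z = 0 → ∃ s ∈ S, ∃ w, f w = s • z) (t : B ⊗[R] F)
    (ht : g.rTensor F t = 0) : ∃ s ∈ S, ∃ w, f.rTensor F w = s • t := by
  have hex : Function.Exact (LinearMap.ker g).subtype g := fun x => by simp
  obtain ⟨k, rfl⟩ := (Module.Flat.rTensor_exact F hex t).1 ht
  induction k with
  | zero => exact ⟨1, S.one_mem, 0, by simp⟩
  | tmul x y =>
    obtain ⟨s, hs, w, hw⟩ := h x x.2
    exact ⟨s, hs, w ⊗ₜ y, by simp [hw, TensorProduct.smul_tmul']⟩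
  | add x y hx hy =>
    have hz (x : LinearMap.ker g ⊗[R] F) :
        g.rTensor F ((LinearMap.ker g).subtype.rTensor F x) = 0 :=
      (Module.Flat.rTensor_exact F hex _).2 ⟨x, rfl⟩
    obtain ⟨s, hs, v, hv⟩ := hx (hz x)
    obtain ⟨t, ht, w, hw⟩ := hy (hz y)
    refine ⟨s * t, S.mul_mem hs ht, t • v + s • w, ?_⟩
    simp only [map_add, map_smul, hv, hw, smul_add, smul_smul, mul_comm s t]

/-- If `S⁻¹Y` is acyclic and `K` is a bounded above complex of flat modules, then `S⁻¹(Y ⊗ K)` is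
acyclic. -/
lemma isTorsionAcyclic_tensor_of_left {S : Submonoid R}
    {Y K : CochainComplex (ModuleCat.{u} R) ℤ} (hY : IsTorsionAcyclic S Y)
    (N : ℤ) [K.IsStrictlyLE N] (hK : ∀ b, Module.Flat R (K.X b)) :
    IsTorsionAcyclic S ((tensorLeft Y).obj K) := by
  rw [isTorsionAcyclic_iff] at hY ⊢
  intro m n p hmn hnp z hz
  -- Induction on the number `l` of columns in which the cocycle `z` may be nonzero. The component
  -- in the lowest such column is a cocycle for the differential of `Y`, so some multiple of it by
  -- an element of `S` is killed by subtracting a coboundary.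
  suffices H : ∀ (l : ℕ) (z : ((tensorLeft Y).obj K).X n),
      (((tensorLeft Y).obj K).d n p).hom z = 0 →
      (∀ b, b < N + 1 - l → tensorπ Y K (n - b) b n z = 0) →
      ∃ s ∈ S, ∃ w, (((tensorLeft Y).obj K).d m n).hom w = s • z by
    obtain ⟨s, hs, -⟩ := exists_tensor_eq_sum z
    obtain ⟨c, hc⟩ := s.bddBelow
    refine H (N + 1 - c).toNat z hz fun b hb => hs b fun hbs => ?_
    have := hc hbs
    omega
  intro l
  induction l with
  | zero =>
    intro z hz h
    refine ⟨1, S.one_mem, 0, ?_⟩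
    rw [map_zero, one_smul, tensor_eq_zero z fun b => ?_]
    by_cases hb : b < N + 1
    · exact h b (by simpa using hb)
    · have := ModuleCat.isZero_iff_subsingleton.1 (K.isZero_of_isStrictlyLE N b (by omega))
      exact Subsingleton.elim _ _
  | succ l ih =>
    intro z hz h
    obtain ⟨b, hb⟩ : ∃ b : ℤ, b = N - l := ⟨_, rfl⟩
    have h1 := tensorπ_d (n - b) (p - b) (b - 1) b n p (by omega) (by omega) hnp (by omega) z
    have h2 : tensorπ Y K (p - b) (b - 1) n z = 0 := by
      have := h (b - 1) (by push_cast; omega)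
      rwa [show n - (b - 1) = p - b by omega] at this
    rw [hz, map_zero, h2, map_zero, smul_zero, add_zero] at h1
    have := hK b
    obtain ⟨s, hs, w, hw⟩ := rTensor_exact_up_to (S := S) _ _
      (hY (m - b) (n - b) (p - b) (by omega) (by omega)) _ h1.symm
    let v := tensorι Y K (m - b) b m (by omega) w
    have hv : (((tensorLeft Y).obj K).d m n).hom v = _ :=
      tensor_d_ι (m - b) b m n (n - b) (b + 1) (by omega) hmn (by omega) rfl w
    obtain ⟨s', hs', w', hw'⟩ := ih (s • z - (((tensorLeft Y).obj K).d m n).hom v) (by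
        rw [map_sub, map_smul, hz, smul_zero, zero_sub, neg_eq_zero]
        exact congrArg (fun f => f.hom v) (((tensorLeft Y).obj K).d_comp_d m n p)) (by
        intro b' hb'
        rw [map_sub, map_smul, hv, map_add, Units.smul_def, map_zsmul,
          tensorπ_ι_ne _ _ _ _ _ _ (show b + 1 ≠ b' by omega), smul_zero, add_zero]
        by_cases hbb : b' = b
        · subst hbb
          rw [tensorπ_ι, hw, sub_self]
        · rw [tensorπ_ι_ne _ _ _ _ _ _ (Ne.symm hbb), h b' (by push_cast; omega), smul_zero,
            sub_self])
    refine ⟨s' * s, S.mul_mem hs' hs, w' + s' • v, ?_⟩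
    rw [map_add, map_smul, hw', smul_sub, sub_add_cancel, smul_smul]

/-- The localization of a complex. -/
abbrev locComplex (S : Submonoid R) (K : CochainComplex (ModuleCat.{u} R) ℤ) :
    CochainComplex (ModuleCat.{u} R) ℤ :=
  ((locFunctor S).mapHomologicalComplex _).obj K

/-- The localization morphism `K ⟶ S⁻¹K`. -/
def toLocComplex (S : Submonoid R) (K : CochainComplex (ModuleCat.{u} R) ℤ) :
    K ⟶ locComplex S K where
  f i := (toLoc S).app (K.X i)
  comm' i j _ := ((toLoc S).naturality (K.d i j)).symm

lemma toLoc_tensor_surj {S : Submonoid R} {Y K : CochainComplex (ModuleCat.{u} R) ℤ} {n : ℤ}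
    (x : ((tensorLeft Y).obj (locComplex S K)).X n) :
    ∃ s ∈ S, ∃ w, (((tensorLeft Y).map (toLocComplex S K)).f n).hom w
      = s • x := by
  let P : ((tensorLeft Y).obj (locComplex S K)).X n → Prop :=
    fun x => ∃ s ∈ S, ∃ w, (((tensorLeft Y).map (toLocComplex S K)).f n).hom w
      = s • x
  have hadd : ∀ x y, P x → P y → P (x + y) := by
    rintro x y ⟨s, hs, v, hv⟩ ⟨t, ht, w, hw⟩
    refine ⟨s * t, S.mul_mem hs ht, t • v + s • w, ?_⟩
    simp only [map_add, map_smul, hv, hw, smul_add, smul_smul, mul_comm s t]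
  have h0 : P 0 := ⟨1, S.one_mem, 0, by simp⟩
  change P x
  obtain ⟨B, -, hx⟩ := exists_tensor_eq_sum x
  rw [hx]
  refine Finset.sum_induction _ P hadd h0 fun b _ => ?_
  generalize tensorπ _ _ (n - b) b n x = t
  induction t with
  | zero => simpa using h0
  | add x y hx hy => rw [map_add]; exact hadd _ _ hx hy
  | tmul y k =>
    obtain ⟨⟨k', s⟩, hk⟩ := IsLocalizedModule.surj S (LocalizedModule.mkLinearMap S (K.X b)) k
    refine ⟨s, s.2, tensorι Y K (n - b) b n (by omega) (y ⊗ₜ k'), ?_⟩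
    rw [tensor_map_ι, ← map_smul, ← TensorProduct.tmul_smul]
    exact congrArg (fun k => tensorι Y (locComplex S K) (n - b) b n (by omega) (y ⊗ₜ k)) hk.symm

lemma toLoc_tensor_inj {S : Submonoid R} {Y K : CochainComplex (ModuleCat.{u} R) ℤ} {n : ℤ}
    (x : ((tensorLeft Y).obj K).X n)
    (hx : (((tensorLeft Y).map (toLocComplex S K)).f n).hom x = 0) :
    ∃ s ∈ S, s • x = 0 := by
  obtain ⟨B, hB, h⟩ := exists_tensor_eq_sum x
  have : ∀ b, ∃ s ∈ S, s • tensorπ Y K (n - b) b n x = 0 := by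
    intro b
    have := tensorπ_map (Y := Y) (toLocComplex S K) (n - b) b n
      (by omega) x
    rw [hx, map_zero] at this
    have h2 : IsLocalizedModule S ((LocalizedModule.mkLinearMap S (K.X b)).rTensor (Y.X (n - b))) :=
      IsLocalizedModule.rTensor (R := R) (A := R) S (LocalizedModule.mkLinearMap S (K.X b))
    have h3 : (LocalizedModule.mkLinearMap S (K.X b)).rTensor (Y.X (n - b))
        (TensorProduct.comm R _ _ (tensorπ Y K (n - b) b n x)) = 0 := by
      rw [LinearMap.rTensor_def, TensorProduct.map_comm, ← LinearMap.lTensor_def]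
      exact (congrArg _ this.symm).trans (map_zero _)
    obtain ⟨s, hs⟩ := (IsLocalizedModule.eq_zero_iff S
      ((LocalizedModule.mkLinearMap S (K.X b)).rTensor (Y.X (n - b)))).1 h3
    rw [Submonoid.smul_def, ← map_smul, LinearEquiv.map_eq_zero_iff] at hs
    exact ⟨s, s.2, hs⟩
  choose s hs hsx using this
  refine ⟨∏ b ∈ B, s b, S.prod_mem fun b _ => hs b, ?_⟩
  rw [h, Finset.smul_sum]
  refine Finset.sum_eq_zero fun b hb => ?_
  obtain ⟨c, hc⟩ := Finset.dvd_prod_of_mem s hb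
  rw [hc, mul_comm, mul_smul, ← map_smul, hsx, map_zero, smul_zero]

/-- If `K` is K-projective and `S⁻¹K` is acyclic, then `S⁻¹(Y ⊗ K)` is acyclic for every complex
`Y`: the morphism `K ⟶ S⁻¹K` is null-homotopic, hence so is `Y ⊗ K ⟶ Y ⊗ S⁻¹K`, which is the
localization of `Y ⊗ K` at `S`. -/
lemma isTorsionAcyclic_tensor_of_right {S : Submonoid R}
    (Y : CochainComplex (ModuleCat.{u} R) ℤ) {K : CochainComplex (ModuleCat.{u} R) ℤ}
    [K.IsKProjective] (hK : IsTorsionAcyclic S K) :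
    IsTorsionAcyclic S ((tensorLeft Y).obj K) := by
  let η := toLocComplex S K
  have hloc : (locComplex S K).Acyclic := by
    intro i
    rw [HomologicalComplex.exactAt_iff_isZero_homology]
    exact (hK i).of_iso ((K.sc i).mapHomologyIso (locFunctor S))
  obtain ⟨H⟩ := CochainComplex.IsKProjective.nonempty_homotopy_zero η hloc
  have H' := (tensorHomotopy Y H).trans (Homotopy.ofEq ((tensorLeft Y).map_zero K (locComplex S K)))
  rw [isTorsionAcyclic_iff]
  intro m n p hmn hnp z hz
  have hzη : ∃ w', ((((tensorLeft Y).obj (locComplex S K)).d m n).hom w'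
      = (((tensorLeft Y).map η).f n).hom z) := by
    have := H'.comm n
    rw [dNext_eq _ (show (ComplexShape.up ℤ).Rel n p from hnp),
      prevD_eq _ (show (ComplexShape.up ℤ).Rel m n from hmn)] at this
    refine ⟨(H'.hom n m).hom z, ?_⟩
    have h3 := congrArg (fun f => f.hom z) this
    refine Eq.symm (h3.trans ?_)
    change (H'.hom p n).hom ((((tensorLeft Y).obj K).d n p).hom z) + _ + 0 = _
    rw [hz, map_zero, zero_add, add_zero]
    rfl
  obtain ⟨w', hw'⟩ := hzη
  obtain ⟨s, hs, w, hw⟩ := toLoc_tensor_surj w'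
  obtain ⟨t, ht, h⟩ := toLoc_tensor_inj (S := S) (s • z - (((tensorLeft Y).obj K).d m n).hom w) (by
    have := congrArg (fun f => f.hom w) (((tensorLeft Y).map η).comm m n)
    rw [map_sub, map_smul]
    change s • (((tensorLeft Y).map η).f n).hom z - _ = 0
    rw [← hw', ← map_smul, ← hw, sub_eq_zero]
    exact this)
  refine ⟨t * s, S.mul_mem ht hs, t • w, ?_⟩
  rw [smul_sub, sub_eq_zero] at h
  rw [mul_smul, h, map_smul]

end

/-! ### The homological functor `S⁻¹H⁰(Y ⊗ -)` -/

section

open TensorProduct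

open HomologicalComplex in
/-- The functor `K ↦ S⁻¹H⁰(Y ⊗ K)` on the homotopy category. -/
def tensorHomologyFunctor (S : Submonoid R) (Y : CochainComplex (ModuleCat.{u} R) ℤ) :
    HomotopyCategory (ModuleCat.{u} R) (.up ℤ) ⥤ ModuleCat.{u} R :=
  CategoryTheory.Quotient.lift _ (tensorLeft Y ⋙ homologyFunctor _ _ 0 ⋙ locFunctor S) (by
    rintro K L f g ⟨h⟩
    exact congrArg (locFunctor S).map ((tensorHomotopy Y h).homologyMap_eq 0))

/-- `tensorHomologyFunctor S Y` is induced by the functor `K ↦ S⁻¹H⁰(Y ⊗ K)` on complexes. -/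
def quotientCompTensorHomologyFunctor (S : Submonoid R)
    (Y : CochainComplex (ModuleCat.{u} R) ℤ) :
    HomotopyCategory.quotient (ModuleCat.{u} R) (.up ℤ) ⋙ tensorHomologyFunctor S Y ≅
      tensorLeft Y ⋙ HomologicalComplex.homologyFunctor _ _ 0 ⋙ locFunctor S :=
  CategoryTheory.Quotient.lift.isLift _ _ _

instance (S : Submonoid R) : (locFunctor S : ModuleCat.{u} R ⥤ ModuleCat.{u} R).Linear R where
  map_smul {M N} f r := by
    simp only [locFunctor, map_smul, ModuleCat.hom_smul]
    rfl

instance (S : Submonoid R) (Y : CochainComplex (ModuleCat.{u} R) ℤ) :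
    (tensorHomologyFunctor S Y).Additive :=
  have := Functor.additive_of_iso (quotientCompTensorHomologyFunctor S Y).symm
  (HomotopyCategory.quotient _ _).additive_of_full_essSurj_comp (tensorHomologyFunctor S Y)

instance (n : ℤ) :
    (HomologicalComplex.homologyFunctor (ModuleCat.{u} R) (.up ℤ) n).Linear R where
  map_smul f r := ShortComplex.homologyMap_smul
    ((HomologicalComplex.shortComplexFunctor (ModuleCat.{u} R) (.up ℤ) n).map f) r

instance (S : Submonoid R) (Y : CochainComplex (ModuleCat.{u} R) ℤ) :
    (tensorHomologyFunctor S Y).Linear R :=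
  have := Functor.linear_of_iso R (quotientCompTensorHomologyFunctor S Y).symm
  (HomotopyCategory.quotient _ _).linear_of_full_essSurj_comp (tensorHomologyFunctor S Y)

/-- The map `(Y ⊗ K)ⁿ ⟶ (Y ⊗ L)ⁿ` induced by maps `Kᵇ ⟶ Lᵇ` that need not commute with the
differentials. -/
def tensorDegreewiseMap (Y : CochainComplex (ModuleCat.{u} R) ℤ)
    {K L : CochainComplex (ModuleCat.{u} R) ℤ} (f : ∀ b, K.X b ⟶ L.X b) (n : ℤ) :
    ((tensorLeft Y).obj K).X n ⟶ ((tensorLeft Y).obj L).X n :=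
  HomologicalComplex.mapBifunctorDesc
    (F := MonoidalCategory.curriedTensor (ModuleCat.{u} R))
    (fun a b h => MonoidalCategory.whiskerLeft (Y.X a) (f b) ≫
      HomologicalComplex.ιTensorObj Y L a b n h)

lemma tensorDegreewiseMap_ι (Y : CochainComplex (ModuleCat.{u} R) ℤ)
    {K L : CochainComplex (ModuleCat.{u} R) ℤ} (f : ∀ b, K.X b ⟶ L.X b) (a b n : ℤ)
    (h : a + b = n) (t : Y.X a ⊗[R] K.X b) :
    (tensorDegreewiseMap Y f n).hom (tensorι Y K a b n h t) =
      tensorι Y L a b n h ((f b).hom.lTensor _ t) :=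
  congrArg (fun f => f.hom t) (HomologicalComplex.ι_mapBifunctorDesc
    (F := MonoidalCategory.curriedTensor (ModuleCat.{u} R)) (c := .up ℤ)
    (fun a b h => MonoidalCategory.whiskerLeft (Y.X a) (f b) ≫
      HomologicalComplex.ιTensorObj Y L a b n h) a b h)

/-- A degreewise splitting of a short complex of complexes induces one after tensoring with `Y`.
-/
def tensorSplitting (Y : CochainComplex (ModuleCat.{u} R) ℤ)
    (T : ShortComplex (CochainComplex (ModuleCat.{u} R) ℤ))
    (σ : ∀ n, (T.map (HomologicalComplex.eval _ _ n)).Splitting) (n : ℤ) :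
    ((T.map (tensorLeft Y)).map (HomologicalComplex.eval _ _ n)).Splitting where
  r := tensorDegreewiseMap Y (fun b => (σ b).r) n
  s := tensorDegreewiseMap Y (fun b => (σ b).s) n
  f_r := by
    ext : 1
    apply tensor_linearMap_ext
    intro a b h y k
    have := congrArg (fun f => f.hom k) (σ b).f_r
    refine (congrArg _ (tensor_map_ι T.f a b n h _)).trans
      ((tensorDegreewiseMap_ι Y _ a b n h _).trans ?_)
    exact congrArg (fun k => tensorι Y _ a b n h (y ⊗ₜ k)) this
  s_g := by
    ext : 1
    apply tensor_linearMap_ext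
    intro a b h y k
    have := congrArg (fun f => f.hom k) (σ b).s_g
    refine (congrArg _ (tensorDegreewiseMap_ι Y _ a b n h _)).trans
      ((tensor_map_ι T.g a b n h _).trans ?_)
    exact congrArg (fun k => tensorι Y _ a b n h (y ⊗ₜ k)) this
  id := by
    ext : 1
    apply tensor_linearMap_ext
    intro a b h y k
    have := congrArg (fun f => f.hom k) (σ b).id
    refine (congrArg₂ (· + ·)
      ((congrArg _ (tensorDegreewiseMap_ι Y _ a b n h _)).trans (tensor_map_ι T.f a b n h _))
      ((congrArg _ (tensor_map_ι T.g a b n h _)).trans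
        (tensorDegreewiseMap_ι Y _ a b n h _))).trans ?_
    refine Eq.trans ?_ (congrArg (fun k => tensorι Y _ a b n h (y ⊗ₜ k)) this)
    rw [← map_add]
    refine congrArg _ ?_
    exact (TensorProduct.tmul_add y _ _).symm

instance (S : Submonoid R) (Y : CochainComplex (ModuleCat.{u} R) ℤ) :
    (tensorHomologyFunctor S Y).IsHomological :=
  Functor.IsHomological.mk' _ (fun T hT => by
    rw [HomotopyCategory.distinguished_iff_iso_trianglehOfDegreewiseSplit] at hT
    obtain ⟨T, σ, ⟨e⟩⟩ := hT
    have hS := HomologicalComplex.shortExact_of_degreewise_shortExact (T.map (tensorLeft Y))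
      (fun n => (tensorSplitting Y T σ n).shortExact)
    exact ⟨_, e, (ShortComplex.exact_iff_of_iso
      (T.mapNatIso (quotientCompTensorHomologyFunctor S Y))).2
        ((hS.homology_exact₂ 0).map (locFunctor S))⟩)

/-- The homological kernel of `tensorHomologyFunctor S Y` consists of the complexes `K` such that
`S⁻¹(Y ⊗ K)` is acyclic. -/
lemma homologicalKernel_quotient_iff (S : Submonoid R) (Y K : CochainComplex (ModuleCat.{u} R) ℤ) :
    (tensorHomologyFunctor S Y).homologicalKernel ((HomotopyCategory.quotient _ _).obj K) ↔
      IsTorsionAcyclic S ((tensorLeft Y).obj K) := by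
  refine forall_congr' fun n => Iso.isZero_iff ?_
  refine (tensorHomologyFunctor S Y).mapIso
    (((HomotopyCategory.quotient _ _).commShiftIso n).symm.app K) ≪≫
    (quotientCompTensorHomologyFunctor S Y).app _ ≪≫ (locFunctor S).mapIso ?_
  exact (HomologicalComplex.homologyFunctor _ _ 0).mapIso
    (((tensorLeft Y).commShiftIso n).app K) ≪≫
    ((HomologicalComplex.homologyFunctor (ModuleCat.{u} R) (.up ℤ) 0).shiftIso
      n 0 n (by simp)).app _

end

/-! ### Projective resolutions and triangles -/

section

open Pretriangulated

section

variable {C : Type*} [Category* C] [Abelian C] [HasDerivedCategory.{w} C]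

/-- Isomorphisms in the derived category between K-projective complexes lift to the homotopy
category. -/
lemma nonempty_iso_of_leftOrthogonal {X Y : HomotopyCategory C (.up ℤ)}
    (hX : (HomotopyCategory.subcategoryAcyclic C).leftOrthogonal X)
    (hY : (HomotopyCategory.subcategoryAcyclic C).leftOrthogonal Y)
    (e : DerivedCategory.Qh.obj X ≅ DerivedCategory.Qh.obj Y) :
    ∃ e' : X ≅ Y, DerivedCategory.Qh.map e'.hom = e.hom := by
  have bij {X Y : HomotopyCategory C (.up ℤ)}
      (hX : (HomotopyCategory.subcategoryAcyclic C).leftOrthogonal X) :=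
    hX.map_bijective_of_isTriangulated DerivedCategory.Qh Y
  obtain ⟨f, hf⟩ := (bij hX).2 e.hom
  obtain ⟨g, hg⟩ := (bij hY).2 e.inv
  exact ⟨⟨f, g, (bij hX).1 (by simp [hf, hg]), (bij hY).1 (by simp [hf, hg])⟩, hf⟩

/-- A distinguished triangle of the derived category whose objects are represented by K-projective
complexes lifts to the homotopy category, with a prescribed lift `f` of the first morphism. -/
lemma exists_distTriang_of_leftOrthogonal {T : Triangle (DerivedCategory C)} (hT : T ∈ distTriang _)
    {X Y Z : HomotopyCategory C (.up ℤ)}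
    (hX : (HomotopyCategory.subcategoryAcyclic C).leftOrthogonal X)
    (hY : (HomotopyCategory.subcategoryAcyclic C).leftOrthogonal Y)
    (hZ : (HomotopyCategory.subcategoryAcyclic C).leftOrthogonal Z)
    (e₁ : DerivedCategory.Qh.obj X ≅ T.obj₁) (e₂ : DerivedCategory.Qh.obj Y ≅ T.obj₂)
    (e₃ : DerivedCategory.Qh.obj Z ≅ T.obj₃) (f : X ⟶ Y)
    (hf : DerivedCategory.Qh.map f ≫ e₂.hom = e₁.hom ≫ T.mor₁) :
    ∃ (g : Y ⟶ Z) (h : Z ⟶ X⟦(1 : ℤ)⟧), Triangle.mk f g h ∈ distTriang _ := by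
  obtain ⟨Z', g, h, hT'⟩ := distinguished_cocone_triangle f
  have hZ' : (HomotopyCategory.subcategoryAcyclic C).leftOrthogonal Z' :=
    ObjectProperty.ext_of_isTriangulatedClosed₃ _ _ hT' hX hY
  let E := isoTriangleOfIso₁₂ _ _ (DerivedCategory.Qh.map_distinguished _ hT') hT e₁ e₂ hf
  obtain ⟨e, -⟩ := nonempty_iso_of_leftOrthogonal hZ' hZ (Triangle.π₃.mapIso E ≪≫ e₃.symm)
  exact ⟨g ≫ e.hom, e.inv ≫ h, isomorphic_distinguished _ hT' _
    (Triangle.isoMk _ _ (Iso.refl X) (Iso.refl Y) e.symm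
      (by change f ≫ 𝟙 Y = 𝟙 X ≫ f; simp)
      (by change (g ≫ e.hom) ≫ e.inv = 𝟙 Y ≫ g; simp)
      (by change (e.inv ≫ h) ≫ (𝟙 X)⟦(1 : ℤ)⟧' = e.inv ≫ h; simp))⟩

end

instance (M : ModuleCat.{u} R) : (projRes M).IsKProjective :=
  inferInstanceAs (projectiveResolution M).cochainComplex.IsKProjective

instance (M : ModuleCat.{u} R) : (projRes M).IsStrictlyLE 0 :=
  inferInstanceAs ((projectiveResolution M).cochainComplex.IsStrictlyLE 0)

instance (M : ModuleCat.{u} R) (n : ℤ) : Projective ((projRes M).X n) :=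
  inferInstanceAs (Projective ((projectiveResolution M).cochainComplex.X n))

lemma flat_projRes_X (M : ModuleCat.{u} R) (n : ℤ) : Module.Flat R ((projRes M).X n) := by
  have : Module.Projective R ((projRes M).X n) :=
    (IsProjective.iff_projective _).2 (inferInstance : Projective ((projRes M).X n))
  infer_instance

/-- The augmentation of the chosen projective resolution of `M`. -/
def projResQuasiIso (M : ModuleCat.{u} R) :
    projRes M ⟶ (CochainComplex.singleFunctor (ModuleCat.{u} R) 0).obj M :=
  (projectiveResolution M).π'

instance (M : ModuleCat.{u} R) : QuasiIso (projResQuasiIso M) :=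
  inferInstanceAs (QuasiIso (projectiveResolution M).π')

/-- The chosen projective resolution of `M` as an object of the homotopy category. -/
abbrev projResHo (M : ModuleCat.{u} R) : HomotopyCategory (ModuleCat.{u} R) (.up ℤ) :=
  (HomotopyCategory.quotient _ _).obj (projRes M)

lemma projResHo_leftOrthogonal (M : ModuleCat.{u} R) :
    (HomotopyCategory.subcategoryAcyclic (ModuleCat.{u} R)).leftOrthogonal (projResHo M) :=
  CochainComplex.IsKProjective.leftOrthogonal (projRes M)

section

variable [HasDerivedCategory.{w} (ModuleCat.{u} R)]

/-- In the derived category the resolution `projResHo M` is isomorphic to `M`. -/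
def projResHoIso (M : ModuleCat.{u} R) :
    DerivedCategory.Qh.obj (projResHo M) ≅ (DerivedCategory.singleFunctor _ 0).obj M :=
  (DerivedCategory.quotientCompQhIso _).app _ ≪≫
    asIso (DerivedCategory.Q.map (projResQuasiIso M)) ≪≫
    (DerivedCategory.singleFunctorIsoCompQ _ 0).symm.app M

end

section

attribute [local instance] HasDerivedCategory.standard

/-- A short exact sequence of modules gives a distinguished triangle of projective resolutions. -/
lemma exists_distTriang_projResHo {T : ShortComplex (ModuleCat.{u} R)} (hT : T.ShortExact) :
    ∃ (f : projResHo T.X₁ ⟶ projResHo T.X₂) (g : projResHo T.X₂ ⟶ projResHo T.X₃)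
      (h : projResHo T.X₃ ⟶ (projResHo T.X₁)⟦(1 : ℤ)⟧), Triangle.mk f g h ∈ distTriang _ := by
  obtain ⟨f, hf⟩ := ((projResHo_leftOrthogonal T.X₁).map_bijective_of_isTriangulated
    DerivedCategory.Qh (projResHo T.X₂)).2
      ((projResHoIso T.X₁).hom ≫ (DerivedCategory.singleFunctor _ 0).map T.f ≫
        (projResHoIso T.X₂).inv)
  obtain ⟨g, h, H⟩ := exists_distTriang_of_leftOrthogonal hT.singleTriangle_distinguished
    (projResHo_leftOrthogonal _) (projResHo_leftOrthogonal _) (projResHo_leftOrthogonal _)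
    (projResHoIso T.X₁) (projResHoIso T.X₂) (projResHoIso T.X₃) f (by
      change _ ≫ (projResHoIso T.X₂).hom =
        (projResHoIso T.X₁).hom ≫ (DerivedCategory.singleFunctor _ 0).map T.f
      rw [hf, Category.assoc, Category.assoc, Iso.inv_hom_id, Category.comp_id])
  exact ⟨f, g, h, H⟩

/-- Variant of `exists_distTriang_projResHo` where the first morphism is multiplication by `r`,
which is then lifted to multiplication by `r` on the projective resolution. -/
lemma exists_distTriang_projResHo_smul (M N : ModuleCat.{u} R) (r : R) (g : M ⟶ N)
    (w : (r • 𝟙 M) ≫ g = 0) (hT : (ShortComplex.mk (r • 𝟙 M) g w).ShortExact) :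
    ∃ (g : projResHo M ⟶ projResHo N)
      (h : projResHo N ⟶ (projResHo M)⟦(1 : ℤ)⟧), Triangle.mk (r • 𝟙 _) g h ∈ distTriang _ := by
  refine exists_distTriang_of_leftOrthogonal hT.singleTriangle_distinguished
    (projResHo_leftOrthogonal _) (projResHo_leftOrthogonal _) (projResHo_leftOrthogonal _)
    (projResHoIso M) (projResHoIso M) (projResHoIso N) (r • 𝟙 _) ?_
  rw [Functor.map_smul, CategoryTheory.Functor.map_id]
  change _ = _ ≫ (DerivedCategory.singleFunctor _ 0).map (r • 𝟙 M)
  rw [Functor.map_smul, CategoryTheory.Functor.map_id, Linear.comp_smul, Linear.smul_comp,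
    Category.id_comp, Category.comp_id]
  rfl

/-! ### Modules with vanishing localized derived tensor product -/

variable (S : Submonoid R) (Y : CochainComplex (ModuleCat.{u} R) ℤ)

/-- The modules `M` with `S⁻¹(Y ⊗ᴸ M) = 0`, where `Y ⊗ᴸ M` is computed on the chosen projective
resolution of `M`. -/
abbrev torKernel : ObjectProperty (ModuleCat.{u} R) :=
  fun M => (tensorHomologyFunctor S Y).homologicalKernel (projResHo M)

lemma torKernel_iff (M : ModuleCat.{u} R) :
    torKernel S Y M ↔ IsTorsionAcyclic S ((tensorLeft Y).obj (projRes M)) :=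
  homologicalKernel_quotient_iff S Y _

variable {Y}

lemma torKernel_X₂ {T : ShortComplex (ModuleCat.{u} R)} (hT : T.ShortExact)
    (h₁ : torKernel S Y T.X₁) (h₃ : torKernel S Y T.X₃) : torKernel S Y T.X₂ := by
  obtain ⟨f, g, h, H⟩ := exists_distTriang_projResHo hT
  exact ObjectProperty.ext_of_isTriangulatedClosed₂ _ _ H h₁ h₃

lemma torKernel_X₁ {T : ShortComplex (ModuleCat.{u} R)} (hT : T.ShortExact)
    (h₂ : torKernel S Y T.X₂) (h₃ : torKernel S Y T.X₃) : torKernel S Y T.X₁ := by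
  obtain ⟨f, g, h, H⟩ := exists_distTriang_projResHo hT
  exact ObjectProperty.ext_of_isTriangulatedClosed₁ _ _ H h₂ h₃

variable (Y) in
/-- If every element of `M` is killed by an element of `S`, then `S⁻¹(Y ⊗ᴸ M) = 0`. -/
lemma torKernel_of_torsion (M : ModuleCat.{u} R) (hM : ∀ m : M, ∃ s ∈ S, s • m = 0) :
    torKernel S Y M := by
  rw [torKernel_iff]
  apply isTorsionAcyclic_tensor_of_right
  intro i
  by_cases hi : i = 0
  · subst hi
    refine IsZero.of_iso ((isZero_locFunctor_iff S M).2 hM) ((locFunctor S).mapIso ?_)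
    exact asIso (HomologicalComplex.homologyMap (projResQuasiIso M) 0) ≪≫
      (HomologicalComplex.homologyFunctorSingleIso (ModuleCat.{u} R) (.up ℤ) 0).app M
  · refine IsZero.of_iso (Functor.map_isZero (locFunctor S) ?_) ((locFunctor S).mapIso
      (asIso (HomologicalComplex.homologyMap (projResQuasiIso M) i)))
    exact (HomologicalComplex.exactAt_single_obj (.up ℤ) 0 M i hi).isZero_homology

lemma exists_smul_eq_zero_locFunctor (S' : Submonoid R) (M : ModuleCat.{u} R)
    (hM : ∀ m : M, ∃ r ∈ S', r • m = 0) (v : (locFunctor S).obj M) : ∃ r ∈ S', r • v = 0 := by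
  change LocalizedModule S M at v
  induction v using LocalizedModule.induction_on with
  | h x s =>
  obtain ⟨r, hr, h0⟩ := hM x
  exact ⟨r, hr, (LocalizedModule.smul'_mk r x s).trans (by rw [h0, LocalizedModule.zero_mk]; rfl)⟩

/-- Suppose `S'⁻¹(Y ⊗ᴸ M) = 0`, and for every `r ∈ S'` multiplication by `r` is injective on `M`
with a cokernel `N` such that `S⁻¹(Y ⊗ᴸ N) = 0`. Then every `r ∈ S'` acts bijectively on the
homology of `S⁻¹(Y ⊗ᴸ M)`, while every element of that homology is killed by some `r ∈ S'`; hence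
`S⁻¹(Y ⊗ᴸ M) = 0`. -/
lemma torKernel_of_smul (S' : Submonoid R) (M : ModuleCat.{u} R) (hM : torKernel S' Y M)
    (h : ∀ r ∈ S', ∃ (N : ModuleCat.{u} R) (g : M ⟶ N) (w : (r • 𝟙 M) ≫ g = 0),
      (ShortComplex.mk (r • 𝟙 M) g w).ShortExact ∧ torKernel S Y N) :
    torKernel S Y M := by
  intro n
  rw [ModuleCat.isZero_iff_subsingleton]
  refine subsingleton_of_forall_eq 0 fun v => ?_
  obtain ⟨r, hr, hrv⟩ : ∃ r ∈ S', r • v = 0 := by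
    exact exists_smul_eq_zero_locFunctor S S' _ ((isZero_locFunctor_iff S' _).1 (hM n)) v
  obtain ⟨N, g, w, hT, hN⟩ := h r hr
  obtain ⟨g, h, H⟩ := exists_distTriang_projResHo_smul M N r g w hT
  have hW : ((tensorHomologyFunctor S Y).homologicalKernel).trW (r • 𝟙 (projResHo M)) :=
    (ObjectProperty.trW_iff_of_distinguished _ _ H).2 hN
  let := Functor.ShiftSequence.tautological (tensorHomologyFunctor S Y) ℤ
  rw [Functor.mem_homologicalKernel_trW_iff] at hW
  have := hW n
  have h2 : IsIso ((tensorHomologyFunctor S Y).map ((r • 𝟙 (projResHo M))⟦n⟧')) := this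
  rw [Functor.map_smul, Functor.map_smul, CategoryTheory.Functor.map_id,
    CategoryTheory.Functor.map_id] at h2
  have h3 := ((ConcreteCategory.isIso_iff_bijective _).1 h2).1
  apply h3
  change r • v = r • 0
  rw [hrv, smul_zero]

end

end

/-! ### Small support and support of the cohomology -/

section

lemma isTorsionAcyclic_bot_iff (Z : CochainComplex (ModuleCat.{u} R) ℤ) :
    IsTorsionAcyclic ⊥ Z ↔ Z.Acyclic := by
  refine forall_congr' fun i => ?_
  rw [isZero_locFunctor_iff, HomologicalComplex.exactAt_iff_isZero_homology,
    ModuleCat.isZero_iff_subsingleton, subsingleton_iff_forall_eq 0]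
  exact forall_congr' fun m => ⟨fun ⟨s, hs, h⟩ => by
    rwa [Submonoid.mem_bot.1 hs, one_smul] at h, fun h => ⟨1, rfl, by rw [h, smul_zero]⟩⟩

lemma IsTorsionAcyclic.of_bot {Z : CochainComplex (ModuleCat.{u} R) ℤ}
    (hZ : IsTorsionAcyclic ⊥ Z) (S : Submonoid R) : IsTorsionAcyclic S Z := by
  intro i
  have := hZ i
  rw [isZero_locFunctor_iff] at this ⊢
  intro m
  obtain ⟨s, hs, h⟩ := this m
  exact ⟨s, by rw [Submonoid.mem_bot.1 hs]; exact S.one_mem, h⟩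

lemma isTorsionAcyclic_primeCompl_iff (p : PrimeSpectrum R)
    (Z : CochainComplex (ModuleCat.{u} R) ℤ) :
    IsTorsionAcyclic p.asIdeal.primeCompl Z ↔ ∀ i, p ∉ Module.support R (Z.homology i) := by
  refine forall_congr' fun i => ?_
  rw [isZero_locFunctor_iff, Module.notMem_support_iff']
  rfl

lemma torKernel_of_bot {Y : CochainComplex (ModuleCat.{u} R) ℤ} {M : ModuleCat.{u} R}
    (h : torKernel ⊥ Y M) (S : Submonoid R) : torKernel S Y M := by
  rw [torKernel_iff] at h ⊢
  exact h.of_bot S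

section

variable [HasDerivedCategory.{w} (ModuleCat.{u} R)]

lemma isZero_Q_obj_iff (Z : CochainComplex (ModuleCat.{u} R) ℤ) :
    IsZero (DerivedCategory.Q.obj Z) ↔ Z.Acyclic := by
  constructor
  · intro h i
    rw [HomologicalComplex.exactAt_iff_isZero_homology]
    exact ((DerivedCategory.homologyFunctorFactors _ i).app Z).isZero_iff.1
      ((DerivedCategory.homologyFunctor _ i).map_isZero h)
  · intro h
    have h0 : QuasiIso (0 : Z ⟶ Z) := ⟨fun i => by
      rw [quasiIsoAt_iff_isIso_homologyMap]
      have hz := (HomologicalComplex.exactAt_iff_isZero_homology _ _).1 (h i)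
      exact ⟨0, hz.eq_of_src _ _, hz.eq_of_src _ _⟩⟩
    have h1 : IsIso (DerivedCategory.Q.map (0 : Z ⟶ Z)) := inferInstance
    rw [IsZero.iff_id_eq_zero]
    refine (IsIso.inv_hom_id (DerivedCategory.Q.map (0 : Z ⟶ Z))).symm.trans ?_
    exact (congrArg _ (Functor.map_zero _ _ _)).trans comp_zero

end

lemma shortExact_of_exact {T : ShortComplex (ModuleCat.{u} R)}
    (hf : Function.Injective T.f) (hfg : Function.Exact T.f T.g) (hg : Function.Surjective T.g) :
    T.ShortExact where
  exact := (ShortComplex.ShortExact.moduleCat_exact_iff_function_exact T).2 hfg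
  mono_f := (ModuleCat.mono_iff_injective _).2 hf
  epi_g := (ModuleCat.epi_iff_surjective _).2 hg

/-- The module `R ⧸ I`. -/
abbrev quotMod (I : Ideal R) : ModuleCat.{u} R := ModuleCat.of R (R ⧸ I)

variable {Y : CochainComplex (ModuleCat.{u} R) ℤ} (S S' : Submonoid R)

/-- Variant of `torKernel_of_smul` with the short exact sequences described by elements. -/
lemma torKernel_of_smul_injective (M : ModuleCat.{u} R) (hM : torKernel S' Y M)
    (hinj : ∀ r ∈ S', ∀ m : M, r • m = 0 → m = 0)
    (h : ∀ r ∈ S', ∃ (N : ModuleCat.{u} R) (g : M ⟶ N), (∀ m, g m = 0 ↔ ∃ m', r • m' = m) ∧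
      Function.Surjective g ∧ torKernel S Y N) : torKernel S Y M := by
  refine torKernel_of_smul S S' M hM fun r hr => ?_
  obtain ⟨N, g, h1, h2, h3⟩ := h r hr
  refine ⟨N, g, ?_, shortExact_of_exact ?_ ?_ h2, h3⟩
  · ext m
    exact (h1 _).2 ⟨m, rfl⟩
  · exact (injective_iff_map_eq_zero (LinearMap.lsmul R M r)).2 (hinj r hr)
  · intro m
    exact h1 m

lemma factor_sup_span_eq_zero_iff {I : Ideal R} (a : R) (x : R ⧸ I) :
    Submodule.factor (le_sup_left : I ≤ I ⊔ Ideal.span {a}) x = 0 ↔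
      ∃ d : R, d • Ideal.Quotient.mk I a = x := by
  obtain ⟨x, rfl⟩ := Submodule.Quotient.mk_surjective _ x
  change Submodule.Quotient.mk x = 0 ↔ _
  rw [Submodule.Quotient.mk_eq_zero, Submodule.mem_sup]
  constructor
  · rintro ⟨y, hy, z, hz, rfl⟩
    obtain ⟨d, rfl⟩ := Ideal.mem_span_singleton'.1 hz
    exact ⟨d, (Submodule.Quotient.eq I).2 (by simpa using hy)⟩
  · rintro ⟨d, hd⟩
    have : d * a - x ∈ I := (Submodule.Quotient.eq I).1 hd
    exact ⟨-(d * a - x), neg_mem this, d * a, Ideal.mem_span_singleton'.2 ⟨d, rfl⟩, by ring⟩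

/-- Devissage of `R ⧸ I` along the exact sequence `0 → R ⧸ (I : a) → R ⧸ I → R ⧸ (I + (a)) → 0`.
-/
lemma torKernel_quot {I : Ideal R} (a : R)
    (h₁ : torKernel S Y (quotMod (LinearMap.ker (LinearMap.toSpanSingleton R (R ⧸ I)
      (Ideal.Quotient.mk I a)))))
    (h₂ : torKernel S Y (quotMod (I ⊔ Ideal.span {a}))) : torKernel S Y (quotMod I) := by
  have hexact : Function.Exact (Submodule.liftQ _ (LinearMap.toSpanSingleton R (R ⧸ I)
      (Ideal.Quotient.mk I a)) le_rfl)
      (Submodule.factor (le_sup_left : I ≤ I ⊔ Ideal.span {a})) := fun x =>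
    (factor_sup_span_eq_zero_iff a x).trans
      ⟨fun ⟨d, hd⟩ => ⟨Submodule.Quotient.mk d, hd⟩, fun ⟨d, hd⟩ => by
        obtain ⟨d, rfl⟩ := Submodule.Quotient.mk_surjective _ d
        exact ⟨d, hd⟩⟩
  refine torKernel_X₂ S (T := ShortComplex.mk
    (ModuleCat.ofHom (Submodule.liftQ _ (LinearMap.toSpanSingleton R (R ⧸ I)
      (Ideal.Quotient.mk I a)) le_rfl))
    (ModuleCat.ofHom (Submodule.factor (le_sup_left : I ≤ I ⊔ Ideal.span {a}))) ?_)
    (shortExact_of_exact ?_ hexact ?_) h₁ h₂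
  · ext : 1
    exact LinearMap.ext hexact.apply_apply_eq_zero
  · exact LinearMap.ker_eq_bot.1 (Submodule.ker_liftQ_eq_bot' _ _ rfl)
  · exact Submodule.factor_surjective (le_sup_left : I ≤ I ⊔ Ideal.span {a})

/-- If `κ(p) ⊗ᴸ Y` vanishes at `p`, so does `R ⧸ p ⊗ᴸ Y`: the cokernel of `R ⧸ p ⟶ κ(p)` vanishes
when localized at `p`. -/
lemma torKernel_quot_of_kappa (p : PrimeSpectrum R)
    (h : torKernel p.asIdeal.primeCompl Y (kappa p)) :
    torKernel p.asIdeal.primeCompl Y (quotMod p.asIdeal) := by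
  let f : (R ⧸ p.asIdeal) →ₗ[R] p.asIdeal.ResidueField :=
    (IsScalarTower.toAlgHom R (R ⧸ p.asIdeal) p.asIdeal.ResidueField).toLinearMap
  have hexact : Function.Exact f (LinearMap.range f).mkQ := f.exact_map_mkQ_range
  refine torKernel_X₁ _ (T := ShortComplex.mk (ModuleCat.ofHom f)
    (ModuleCat.ofHom (LinearMap.range f).mkQ) ?_)
    (shortExact_of_exact ?_ hexact (Submodule.mkQ_surjective _)) h
      (torKernel_of_torsion _ _ _ ?_)
  · ext : 1
    exact LinearMap.ext hexact.apply_apply_eq_zero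
  · exact Ideal.injective_algebraMap_quotient_residueField _
  · intro x
    obtain ⟨x, rfl⟩ := Submodule.mkQ_surjective _ x
    obtain ⟨⟨a, s, hs⟩, has⟩ := IsLocalization.surj (nonZeroDivisors (R ⧸ p.asIdeal)) x
    obtain ⟨s, rfl⟩ := Ideal.Quotient.mk_surjective s
    refine ⟨s, fun hsp => nonZeroDivisors.ne_zero hs (Ideal.Quotient.eq_zero_iff_mem.2 hsp), ?_⟩
    rw [← map_smul, Submodule.mkQ_apply, Submodule.Quotient.mk_eq_zero]
    refine ⟨a, has.symm.trans ?_⟩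
    rw [mul_comm, Algebra.smul_def]
    rfl

/-- Localizing at `p` does not change `Y ⊗ᴸ κ(p)`, because every `r ∉ p` acts bijectively on
`κ(p)`. -/
lemma torKernel_kappa (p : PrimeSpectrum R) (h : torKernel p.asIdeal.primeCompl Y (kappa p)) :
    torKernel ⊥ Y (kappa p) := by
  have hne {r : R} (hr : r ∈ p.asIdeal.primeCompl) :
      algebraMap R p.asIdeal.ResidueField r ≠ 0 := fun h0 =>
    hr (Ideal.algebraMap_residueField_eq_zero.1 h0)
  refine torKernel_of_smul_injective ⊥ _ (kappa p) h (fun r hr m hm => ?_) fun r hr =>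
    ⟨ModuleCat.of R PUnit, 0, fun m => ⟨fun _ => ?_, fun _ => rfl⟩, fun _ => ⟨0, rfl⟩,
      torKernel_of_torsion _ _ _ fun m => ⟨1, one_mem _, rfl⟩⟩
  · have hm' : algebraMap R p.asIdeal.ResidueField r * m = 0 := by
      rwa [← Algebra.smul_def]
    exact (mul_eq_zero.1 hm').resolve_left (hne hr)
  · change p.asIdeal.ResidueField at m
    refine ⟨(algebraMap R p.asIdeal.ResidueField r)⁻¹ * m, ?_⟩
    refine (Algebra.smul_def _ _).trans ?_
    rw [mul_inv_cancel_left₀ (hne hr)]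

/-- If `Y ⊗ᴸ R ⧸ p` vanishes at `p` and `S⁻¹(Y ⊗ᴸ R ⧸ J) = 0` for all ideals `J` strictly
containing `p`, then `S⁻¹(Y ⊗ᴸ R ⧸ p) = 0`. -/
lemma torKernel_quot_of_lt (p : PrimeSpectrum R)
    (h : torKernel p.asIdeal.primeCompl Y (quotMod p.asIdeal))
    (h' : ∀ J, p.asIdeal < J → torKernel S Y (quotMod J)) :
    torKernel S Y (quotMod p.asIdeal) := by
  refine torKernel_of_smul_injective _ _ (quotMod p.asIdeal) h (fun r hr m hm => ?_) fun r hr =>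
    ⟨quotMod (p.asIdeal ⊔ Ideal.span {r}), ModuleCat.ofHom (Submodule.factor le_sup_left),
      fun m => (factor_sup_span_eq_zero_iff r m).trans ?_,
      Submodule.factor_surjective (le_sup_left : p.asIdeal ≤ p.asIdeal ⊔ Ideal.span {r}), h' _ ?_⟩
  · obtain ⟨m, rfl⟩ := Ideal.Quotient.mk_surjective m
    have : r * m ∈ p.asIdeal := Ideal.Quotient.eq_zero_iff_mem.1 hm
    exact Ideal.Quotient.eq_zero_iff_mem.2 ((p.isPrime.mem_or_mem this).resolve_left hr)
  · have (d : R) : d • Ideal.Quotient.mk p.asIdeal r = r • Ideal.Quotient.mk p.asIdeal d :=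
      congrArg (Ideal.Quotient.mk p.asIdeal) (mul_comm d r)
    exact ⟨fun ⟨d, hd⟩ => ⟨Ideal.Quotient.mk _ d, (this d).symm.trans hd⟩, fun ⟨d, hd⟩ => by
      obtain ⟨d, rfl⟩ := Ideal.Quotient.mk_surjective d
      exact ⟨d, (this d).trans hd⟩⟩
  · exact lt_of_le_of_ne le_sup_left fun h => hr (h ▸ Ideal.mem_sup_right
      (Ideal.mem_span_singleton_self r))

/-- If the small support of `Y` is contained in the specialization-closed set `W` and `q ∉ W`,
then `Y ⊗ᴸ R ⧸ I` vanishes at `q` for every ideal `I`. This is proved by Noetherian induction on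
`I`. -/
lemma torKernel_quot_of_notMem [IsNoetherianRing R] {W : Set (PrimeSpectrum R)}
    (hW : StableUnderSpecialization W) (h : ∀ p, p ∉ W → torKernel ⊥ Y (kappa p))
    (q : PrimeSpectrum R) (hq : q ∉ W) (I : Ideal R) :
    torKernel q.asIdeal.primeCompl Y (quotMod I) := by
  induction I using IsNoetherian.induction with
  | hgt I ih =>
  change Ideal R at I
  by_cases hI : I ≤ q.asIdeal
  · by_cases hIp : I.IsPrime
    · have hI' : (⟨I, hIp⟩ : PrimeSpectrum R) ∉ W := fun hp =>
        hq (hW ((PrimeSpectrum.le_iff_specializes _ _).1 hI) hp)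
      exact torKernel_quot_of_lt _ ⟨I, hIp⟩
        (torKernel_quot_of_kappa _ (torKernel_of_bot (h _ hI') _)) ih
    · obtain ⟨a, ha, b, hb, hab⟩ := (Ideal.not_isPrime_iff.1 hIp).resolve_left
        fun h => q.isPrime.ne_top (top_le_iff.1 (h ▸ hI))
      refine torKernel_quot _ a (ih _ (lt_of_le_of_ne ?_ ?_)) (ih _ (lt_of_le_of_ne le_sup_left ?_))
      · intro x hx
        exact Ideal.Quotient.eq_zero_iff_mem.2 (I.mul_mem_right a hx)
      · intro h
        apply hb
        rw [h]
        have hab' : b * a ∈ I := by rwa [mul_comm]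
        exact Ideal.Quotient.eq_zero_iff_mem.2 hab'
      · exact fun h => ha (h ▸ Ideal.mem_sup_right (Ideal.mem_span_singleton_self a))
  · obtain ⟨s, hs, hsq⟩ := Set.not_subset.1 hI
    refine torKernel_of_torsion _ _ _ fun m => ⟨s, hsq, ?_⟩
    obtain ⟨m, rfl⟩ := Ideal.Quotient.mk_surjective m
    exact Ideal.Quotient.eq_zero_iff_mem.2 (I.mul_mem_right m hs)

attribute [local instance] HasDerivedCategory.standard in
/-- `Y ⊗ᴸ R` is `Y`. -/
lemma torKernel_unit_iff : torKernel S Y (ModuleCat.of R R) ↔ IsTorsionAcyclic S Y := by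
  let K : CochainComplex (ModuleCat.{u} R) ℤ := HomologicalComplex.tensorUnit _ _
  let K' : CochainComplex (ModuleCat.{u} R) ℤ :=
    (CochainComplex.singleFunctor (ModuleCat.{u} R) 0).obj (ModuleCat.of R R)
  have hp : Projective (ModuleCat.of R R) := inferInstance
  have : ∀ n, Projective (K'.X n) := fun n => by
    by_cases hn : n = 0
    · subst hn
      exact Projective.of_iso (HomologicalComplex.singleObjXSelf (.up ℤ) 0 _).symm hp
    · exact (HomologicalComplex.isZero_single_obj_X (.up ℤ) 0 _ n hn).projective
  have hK : K'.IsKProjective := CochainComplex.isKProjective_of_projective K' 0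
  obtain ⟨e, -⟩ := nonempty_iso_of_leftOrthogonal (projResHo_leftOrthogonal (ModuleCat.of R R))
    (CochainComplex.IsKProjective.leftOrthogonal K')
    (projResHoIso (ModuleCat.of R R) ≪≫ (DerivedCategory.singleFunctorIsoCompQ _ 0).app _ ≪≫
      ((DerivedCategory.quotientCompQhIso _).app _).symm)
  have h1 : torKernel S Y (ModuleCat.of R R) ↔ IsTorsionAcyclic S ((tensorLeft Y).obj K) :=
    (ObjectProperty.prop_iff_of_iso _ e).trans (homologicalKernel_quotient_iff S Y K')
  rw [h1]
  exact forall_congr' fun i => Iso.isZero_iff ((locFunctor S).mapIso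
    ((HomologicalComplex.homologyFunctor _ _ i).mapIso (HomologicalComplex.rightUnitor Y)))

/-- The small support of `Y` is contained in the specialization-closed set `W` if and only if the
big supports of the cohomology modules of `Y` are. -/
lemma forall_torKernel_kappa_iff [IsNoetherianRing R] {W : Set (PrimeSpectrum R)}
    (hW : StableUnderSpecialization W) (Y : CochainComplex (ModuleCat.{u} R) ℤ) :
    (∀ p, p ∉ W → torKernel ⊥ Y (kappa p)) ↔ ∀ i, Module.support R (Y.homology i) ⊆ W := by
  constructor
  · intro h i q hq
    by_contra hqW
    have h1 : torKernel q.asIdeal.primeCompl Y (ModuleCat.of R R) := by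
      refine torKernel_X₂ _ (T := ShortComplex.mk (0 : ModuleCat.of R PUnit ⟶ ModuleCat.of R R)
        (ModuleCat.ofHom (Submodule.mkQ ⊥)) zero_comp) (shortExact_of_exact ?_ ?_ ?_)
        (torKernel_of_torsion _ _ _ fun m => ⟨1, one_mem _, rfl⟩)
        (torKernel_quot_of_notMem hW h q hqW ⊥)
      · exact fun _ _ _ => rfl
      · exact fun m => ((Submodule.Quotient.mk_eq_zero ⊥).trans (Submodule.mem_bot R)).trans
          ⟨fun h => ⟨0, h.symm⟩, fun ⟨_, h⟩ => h.symm⟩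
      · exact Submodule.mkQ_surjective _
    exact (isTorsionAcyclic_primeCompl_iff q Y).1 ((torKernel_unit_iff _).1 h1) i hq
  · intro h p hp
    refine torKernel_kappa p ?_
    rw [torKernel_iff]
    exact isTorsionAcyclic_tensor_of_left ((isTorsionAcyclic_primeCompl_iff _ _).2
      fun i hi => hp (h i hi)) 0 (flat_projRes_X _)

variable [HasDerivedCategory.{w} (ModuleCat.{u} R)]

lemma subcategoryOfSupport_iff [IsNoetherianRing R] {W : Set (PrimeSpectrum R)}
    (hW : StableUnderSpecialization W) (X : DerivedCategory (ModuleCat.{u} R)) :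
    subcategoryOfSupport W X ↔
      ∀ i, Module.support R ((DerivedCategory.homologyFunctor (ModuleCat.{u} R) i).obj X) ⊆ W := by
  have h1 : subcategoryOfSupport W X ↔
      ∀ p, p ∉ W → torKernel ⊥ (DerivedCategory.Q.objPreimage X) (kappa p) := by
    refine forall_congr' fun p => ?_
    rw [torKernel_iff, isTorsionAcyclic_bot_iff, ← isZero_Q_obj_iff.{w}]
    exact not_imp_comm
  rw [h1, forall_torKernel_kappa_iff hW]
  refine forall_congr' fun i => ?_
  have := LinearEquiv.support_eq (((DerivedCategory.homologyFunctorFactors _ i).app _).symm ≪≫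
    (DerivedCategory.homologyFunctor _ i).mapIso
      (DerivedCategory.Q.objObjPreimageIso X)).toLinearEquiv
  rw [← this]
  rfl

lemma subcategoryOfSupport_Q_iff [IsNoetherianRing R] {W : Set (PrimeSpectrum R)}
    (hW : StableUnderSpecialization W) (X : CochainComplex (ModuleCat.{u} R) ℤ) :
    subcategoryOfSupport W (DerivedCategory.Q.obj X) ↔
      ∀ i, Module.support R (X.homology i) ⊆ W := by
  rw [subcategoryOfSupport_iff hW]
  refine forall_congr' fun i => ?_
  exact iff_of_eq (congrArg (· ⊆ W) (LinearEquiv.support_eq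
    ((DerivedCategory.homologyFunctorFactors _ i).app X).toLinearEquiv))

end

/-! ### The torsion functor preserves injective modules -/

section

lemma exists_comp_eq_of_ker_le {A B J : Type u} [AddCommGroup A] [AddCommGroup B] [AddCommGroup J]
    [Module R A] [Module R B] [Module R J] [Module.Injective R J] (f : A →ₗ[R] B) (v : A →ₗ[R] J)
    (h : LinearMap.ker f ≤ LinearMap.ker v) : ∃ β : B →ₗ[R] J, β ∘ₗ f = v := by
  obtain ⟨β, hβ⟩ := Module.Injective.out ((LinearMap.ker f).liftQ f le_rfl)
    (LinearMap.ker_eq_bot.1 (Submodule.ker_liftQ_eq_bot' _ _ rfl)) ((LinearMap.ker f).liftQ v h)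
  exact ⟨β, LinearMap.ext fun x => hβ (Submodule.Quotient.mk x)⟩

lemma mem_gammaSubmodule_iff {W : Set (PrimeSpectrum R)} {M : Type*} [AddCommGroup M] [Module R M]
    {x : M} : x ∈ gammaSubmodule W M ↔ ∀ p, p ∉ W → ∃ r ∉ p.asIdeal, r • x = 0 := by
  refine forall_congr' fun p => ?_
  rw [mem_support_span_singleton_iff, ← not_imp_not]
  refine imp_congr_right fun _ => ?_
  push Not
  exact exists_congr fun r => and_comm

variable (W : Set (PrimeSpectrum R))

/-- Over a Noetherian ring `Γ_W(J)` is injective when `J` is. A map `f : I → Γ_W(J)` from an ideal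
is killed by an ideal `b` with `V(b) ⊆ W`. By Artin–Rees `I ∩ bⁿ ⊆ bI` for some `n`, so `f`
factors through the image of `I` in `R ⧸ bⁿ`; it extends to a map `R ⧸ bⁿ → J`, which has values
in `Γ_W(J)`. -/
lemma injective_gammaSubmodule [IsNoetherianRing R] (J : Type u) [AddCommGroup J] [Module R J]
    [Module.Injective R J] : Module.Injective R (gammaSubmodule W J) := by
  refine Module.Baer.injective fun I f => ?_
  let b : Ideal R := Module.annihilator R (LinearMap.range f)
  have hb : ∀ p : PrimeSpectrum R, b ≤ p.asIdeal → p ∈ W := by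
    intro p hp
    by_contra hpW
    have h1 : p ∈ Module.support R (LinearMap.range f) := by
      rw [Module.support_eq_zeroLocus]
      exact hp
    obtain ⟨⟨⟨m, hm⟩, hm'⟩, h2⟩ := Module.mem_support_iff'.1 h1
    obtain ⟨r, hr, h3⟩ := mem_gammaSubmodule_iff.1 hm p hpW
    exact h2 r hr (Subtype.ext (Subtype.ext h3))
  obtain ⟨k, hk⟩ := Ideal.exists_pow_inf_eq_pow_smul b I
  have hker : LinearMap.ker (Submodule.mkQ (b ^ (k + 1)) ∘ₗ I.subtype) ≤
      LinearMap.ker ((gammaSubmodule W J).subtype ∘ₗ f) := by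
    rintro ⟨x, hx⟩ hxb
    have hxb' : x ∈ b ^ (k + 1) := (Submodule.Quotient.mk_eq_zero _).1 hxb
    have h1 : x ∈ b • I := by
      have h2 : x ∈ b ^ (k + 1) • (⊤ : Ideal R) ⊓ I := ⟨by simpa using hxb', hx⟩
      rw [hk (k + 1) (by omega), Nat.add_sub_cancel_left, pow_one] at h2
      exact Submodule.smul_mono le_rfl inf_le_right h2
    have h3 : ∀ y (hy : y ∈ b • I), f ⟨y, Submodule.smul_le_right hy⟩ = 0 := by
      intro y hy
      induction hy using Submodule.smul_induction_on' with
      | smul r hr n hn =>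
        have := Module.mem_annihilator.1 hr ⟨f ⟨n, hn⟩, _, rfl⟩
        refine Eq.trans ?_ (congrArg Subtype.val this)
        exact f.map_smul r ⟨n, hn⟩
      | add x hx y hy h1 h2 =>
        refine (f.map_add ⟨x, Submodule.smul_le_right hx⟩ ⟨y, Submodule.smul_le_right hy⟩).trans ?_
        rw [h1, h2, add_zero]
    exact congrArg Subtype.val (h3 x h1)
  obtain ⟨g, hg⟩ := exists_comp_eq_of_ker_le _ _ hker
  have hgm (x : R ⧸ b ^ (k + 1)) : g x ∈ gammaSubmodule W J := by
    refine mem_gammaSubmodule_iff.2 fun p hp => ?_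
    obtain ⟨r, hr, hrp⟩ := Set.not_subset.1 fun h => hp (hb p (p.isPrime.le_of_pow_le h))
    refine ⟨r, hrp, ?_⟩
    obtain ⟨x, rfl⟩ := Ideal.Quotient.mk_surjective x
    rw [← map_smul]
    refine (congrArg g ?_).trans g.map_zero
    exact Ideal.Quotient.eq_zero_iff_mem.2 (Ideal.mul_mem_right _ _ hr)
  refine ⟨(g.codRestrict _ hgm) ∘ₗ Submodule.mkQ _, fun x hx => ?_⟩
  exact Subtype.ext (LinearMap.congr_fun hg ⟨x, hx⟩)

instance [IsNoetherianRing R] (J : ModuleCat.{u} R) [Injective J] :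
    Injective ((gammaFunctor W).obj J) := by
  have := Module.injective_module_of_injective_object R J
  have := injective_gammaSubmodule W J
  exact Module.injective_object_of_injective_module R (gammaSubmodule W J)

/-- The inclusion `Γ_W(J) ⟶ J`. -/
abbrev gammaι (J : ModuleCat.{u} R) : (gammaFunctor W).obj J ⟶ J :=
  (gammaInclusion W).app J

lemma gammaι_naturality {J J' : ModuleCat.{u} R} (f : J ⟶ J') :
    (gammaFunctor W).map f ≫ gammaι W J' = gammaι W J ≫ f :=
  (gammaInclusion W).naturality f

instance (J : ModuleCat.{u} R) : Mono (gammaι W J) :=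
  (ModuleCat.mono_iff_injective _).2 (gammaSubmodule W J).injective_subtype

/-- The morphism `a : A ⟶ J` has values in `Γ_W(J)`. -/
def IsGammaValued {A J : ModuleCat.{u} R} (a : A ⟶ J) : Prop :=
  ∃ b : A ⟶ (gammaFunctor W).obj J, b ≫ gammaι W J = a

section

variable {W} {A B J J' : ModuleCat.{u} R}

lemma IsGammaValued.zero_of_isZero {a : A ⟶ J} (h : IsZero J) : IsGammaValued W a :=
  ⟨0, h.eq_of_tgt _ _⟩

lemma IsGammaValued.sub {a a' : A ⟶ J} (ha : IsGammaValued W a) (ha' : IsGammaValued W a') :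
    IsGammaValued W (a - a') := by
  obtain ⟨b, rfl⟩ := ha
  obtain ⟨b', rfl⟩ := ha'
  exact ⟨b - b', Preadditive.sub_comp _ _ _⟩

lemma IsGammaValued.units_smul_iff {a : A ⟶ J} (r : ℤˣ) :
    IsGammaValued W (r • a) ↔ IsGammaValued W a := by
  have (r : ℤˣ) (a : A ⟶ J) (h : IsGammaValued W a) : IsGammaValued W (r • a) := by
    obtain ⟨b, rfl⟩ := h
    exact ⟨r • b, Linear.units_smul_comp _ _ _⟩
  exact ⟨fun h => by simpa [smul_smul] using this r _ h, this r a⟩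

lemma IsGammaValued.postcomp {a : A ⟶ J} (ha : IsGammaValued W a) (f : J ⟶ J') :
    IsGammaValued W (a ≫ f) := by
  obtain ⟨b, rfl⟩ := ha
  exact ⟨b ≫ (gammaFunctor W).map f, by
    rw [Category.assoc, gammaι_naturality, Category.assoc]⟩

end

variable {W}

lemma exists_retraction [IsNoetherianRing R] (J : ModuleCat.{u} R) [Injective J] :
    ∃ p : J ⟶ (gammaFunctor W).obj J, gammaι W J ≫ p = 𝟙 _ :=
  ⟨Injective.factorThru (𝟙 _) _, Injective.comp_factorThru _ _⟩

/-- If `Hᵐ(X)` is supported in `W`, then a map `f : Xᵐ ⟶ J` to an injective module which is a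
cocycle modulo `Γ_W(J)` is a coboundary modulo `Γ_W(J)`. Indeed `Γ_W(J)` is a direct summand of
`J`; the component of `f` in a complement sends cocycles of `X` to elements of `Γ_W(J)`, hence to
`0`. -/
lemma exists_isGammaValued_sub [IsNoetherianRing R] {X : CochainComplex (ModuleCat.{u} R) ℤ}
    {l m m' : ℤ} (hl : l + 1 = m) (hm : m + 1 = m') (hX : Module.support R (X.homology m) ⊆ W)
    {J : ModuleCat.{u} R} [Injective J] (f : X.X m ⟶ J) (hf : IsGammaValued W (X.d l m ≫ f)) :
    ∃ β : X.X m' ⟶ J, IsGammaValued W (f - X.d m m' ≫ β) := by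
  obtain ⟨p, hp⟩ := exists_retraction (W := W) J
  let v := f - f ≫ p ≫ gammaι W J
  have hv0 : X.d l m ≫ v = 0 := by
    obtain ⟨b, hb⟩ := hf
    rw [Preadditive.comp_sub, ← Category.assoc, ← hb, Category.assoc, reassoc_of% hp, sub_self]
  have hvp : v ≫ p = 0 := by
    rw [Preadditive.sub_comp, Category.assoc, Category.assoc, hp, Category.comp_id, sub_self]
  have := Module.injective_module_of_injective_object R J
  obtain ⟨β, hβ⟩ := exists_comp_eq_of_ker_le (X.d m m').hom v.hom (fun x hx => by
    have hmem : v x ∈ gammaSubmodule W J := by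
      refine mem_gammaSubmodule_iff.2 fun q hq => ?_
      have h1 : IsZero ((locFunctor q.asIdeal.primeCompl).obj (X.homology m)) :=
        (isZero_locFunctor_iff _ _).2 (Module.notMem_support_iff'.1 fun h => hq (hX h))
      obtain ⟨s, hs, w, hw⟩ := (isZero_locFunctor_homology_iff _ X l m m' hl hm).1 h1 x hx
      refine ⟨s, hs, ?_⟩
      change s • v.hom x = 0
      rw [← map_smul, ← hw]
      exact congrArg (fun g => g.hom w) hv0
    have h2 : v x = gammaι W J (p (v x)) := by
      have := congrArg (fun g => gammaι W J (g.hom ⟨v x, hmem⟩)) hp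
      exact this.symm
    have h3 : p (v x) = 0 := congrArg (fun g => g.hom x) hvp
    rw [h3] at h2
    exact h2.trans (map_zero _))
  refine ⟨ModuleCat.ofHom β, f ≫ p, ?_⟩
  have h4 : X.d m m' ≫ ModuleCat.ofHom β = v := ModuleCat.hom_ext hβ
  rw [h4, Category.assoc, sub_sub_cancel]

end

/-! ### Cocycles with values in the torsion subcomplex -/

section

open CochainComplex.HomComplex

/-- The map `Hⁱ(Hom•(X, L)) → Hⁱ(Hom•(X, L'))` induced by `f : L ⟶ L'` is bijective, expressed
with cocycles and coboundaries. -/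
structure CohomologyBijective (X : CochainComplex (ModuleCat.{u} R) ℤ)
    {L L' : CochainComplex (ModuleCat.{u} R) ℤ} (f : L ⟶ L') (i : ℤ) : Prop where
  inj : ∀ z : Cochain X L i, δ i (i + 1) z = 0 → ∀ y' : Cochain X L' (i - 1),
    δ (i - 1) i y' = z.comp (Cochain.ofHom f) (add_zero i) →
      ∃ y : Cochain X L (i - 1), δ (i - 1) i y = z
  surj : ∀ z' : Cochain X L' i, δ i (i + 1) z' = 0 →
    ∃ (z : Cochain X L i) (y' : Cochain X L' (i - 1)), δ i (i + 1) z = 0 ∧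
      δ (i - 1) i y' = z' - z.comp (Cochain.ofHom f) (add_zero i)

variable {W : Set (PrimeSpectrum R)}
  {X I : CochainComplex (ModuleCat.{u} R) ℤ}

/-- A cochain with values in `Γ_W(I)` comes from `Γ_W(I)`. -/
lemma exists_comp_gammaComplexι {j : ℤ} (z : Cochain X I j)
    (hz : ∀ m q (h : m + j = q), IsGammaValued W (z.v m q h)) :
    ∃ w : Cochain X (gammaComplex W I) j,
      w.comp (Cochain.ofHom (gammaComplexι W I)) (add_zero j) = z := by
  choose b hb using hz
  refine ⟨Cochain.mk b, ?_⟩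
  refine Cochain.ext _ _ fun m q h => ?_
  rw [Cochain.comp_zero_cochain_v, Cochain.ofHom_v]
  exact hb m q h

lemma comp_gammaComplexι_injective {j : ℤ} {z z' : Cochain X (gammaComplex W I) j}
    (h : z.comp (Cochain.ofHom (gammaComplexι W I)) (add_zero j) =
      z'.comp (Cochain.ofHom (gammaComplexι W I)) (add_zero j)) : z = z' := by
  refine Cochain.ext _ _ fun m q hmq => ?_
  have := Cochain.congr_v h m q hmq
  rw [Cochain.comp_zero_cochain_v, Cochain.comp_zero_cochain_v, Cochain.ofHom_v] at this
  exact (cancel_mono (gammaι W (I.X q))).1 this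

lemma isGammaValued_comp_gammaComplexι {j : ℤ} (w : Cochain X (gammaComplex W I) j) (m q : ℤ)
    (h : m + j = q) : IsGammaValued W
      ((w.comp (Cochain.ofHom (gammaComplexι W I)) (add_zero j)).v m q h) :=
  ⟨w.v m q h, by rw [Cochain.comp_zero_cochain_v, Cochain.ofHom_v]; rfl⟩

/-- If `δz` has values in `Γ_W(I)`, and so do the components of the cochain `z` on `Xᵐ`, then so
do the components of `z` on `Xᵐ⁺¹` composed with the differential of `X`. -/
lemma isGammaValued_d_comp {j j' : ℤ} (hj : j + 1 = j') {z : Cochain X I j}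
    (hz : ∀ m q (h : m + j' = q), IsGammaValued W ((δ j j' z).v m q h)) {m m' q : ℤ}
    (hm : m + 1 = m') (hq : m' + j = q)
    (h : ∀ q (h : m + j = q), IsGammaValued W (z.v m q h)) :
    IsGammaValued W (X.d m m' ≫ z.v m' q hq) := by
  have h1 := hz m q (by omega)
  rw [δ_v j j' hj z m q (by omega) (q - 1) m' rfl hm] at h1
  have h2 := h1.sub ((h (q - 1) (by omega)).postcomp (I.d (q - 1) q))
  rw [add_sub_cancel_left] at h2
  exact (IsGammaValued.units_smul_iff _).1 h2

variable [IsNoetherianRing R]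

/-- If `δz` has values in `Γ_W(I)` and `Hᵐ(X)` is supported in `W` for `m ≤ N`, then some cochain
cohomologous to `z` has values in `Γ_W(I)` on `Xᵐ` for all `m ≤ N`. It is constructed by induction
on `m`, starting in a degree where `I` is zero. -/
lemma exists_isGammaValued_sub_δ (hI : ∀ q, Injective (I.X q)) (d : ℤ)
    (hd : ∀ q < d, IsZero (I.X q)) {j j₀ j' : ℤ} (hj₀ : j₀ + 1 = j) (hj : j + 1 = j')
    (z : Cochain X I j)
    (hz : ∀ m q (h : m + j' = q), IsGammaValued W ((δ j j' z).v m q h)) (N : ℤ)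
    (hX : ∀ m ≤ N, Module.support R (X.homology m) ⊆ W) :
    ∃ k : Cochain X I j₀, ∀ m q (h : m + j = q), m ≤ N →
      IsGammaValued W ((z - δ j₀ j k).v m q h) := by
  have key (t : ℕ) : ∃ k : Cochain X I j₀, ∀ m q (h : m + j = q), m ≤ N → m < d - j + t →
      IsGammaValued W ((z - δ j₀ j k).v m q h) := by
    induction t with
    | zero =>
      exact ⟨0, fun m q h _ hm => .zero_of_isZero (hd q (by push_cast at hm; omega))⟩
    | succ t ih =>
      obtain ⟨k, hk⟩ := ih
      let m₁ : ℤ := d - j + t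
      by_cases hN : m₁ ≤ N
      swap
      · exact ⟨k, fun m q h hm _ => hk m q h hm (by omega)⟩
      obtain ⟨β, hβ⟩ := exists_isGammaValued_sub (J := I.X (m₁ + j)) (l := m₁ - 1)
        (sub_add_cancel _ _) rfl (hX m₁ hN) ((z - δ j₀ j k).v m₁ _ rfl)
        (isGammaValued_d_comp hj (by simpa [δ_δ] using hz) (sub_add_cancel _ _) _
          fun q h => hk _ q h (by omega) (by omega))
      refine ⟨k + j.negOnePow • Cochain.single β j₀, fun m q h hm hmt => ?_⟩
      have hsplit : (z - δ j₀ j (k + j.negOnePow • Cochain.single β j₀)).v m q h =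
          (z - δ j₀ j k).v m q h - j.negOnePow • (δ j₀ j (Cochain.single β j₀)).v m q h := by
        simp [sub_sub]
      rw [hsplit, δ_v j₀ j hj₀ _ m q h (q - 1) (m + 1) rfl rfl,
        Cochain.single_v_eq_zero _ _ m (q - 1) _ (by omega), zero_comp, zero_add, smul_smul]
      obtain hlt | rfl : m < m₁ ∨ m = m₁ := by push_cast at hmt; omega
      · rw [Cochain.single_v_eq_zero _ _ (m + 1) q _ (by omega), comp_zero, smul_zero, sub_zero]
        exact hk m q h hm hlt
      · subst h
        simpa [Cochain.single_v] using hβ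
  obtain ⟨k, hk⟩ := key (N + 1 - (d - j)).toNat
  exact ⟨k, fun m q h hm => hk m q h hm (by omega)⟩

/-- The inclusion `Γ_W(I) ⟶ I` induces a bijection on `Hⁱ(Hom•(X, -))` as soon as `Hᵐ(X)` is
supported in `W` for all `m ≤ n - i`, where `n` bounds the degrees of `I` from above. -/
theorem cohomologyBijective_gammaComplexι {n : ℤ} (hI : IsBoundedInjective I n) (i : ℤ)
    (hX : ∀ m, m + i ≤ n → Module.support R (X.homology m) ⊆ W) :
    CohomologyBijective X (gammaComplexι W I) i := by
  obtain ⟨d, hd⟩ := hI.isZero_below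
  have hinj := hI.injective
  constructor
  · intro z hz y' hy'
    obtain ⟨k, hk⟩ := exists_isGammaValued_sub_δ (W := W) hinj d hd
      (j₀ := i - 2) (j := i - 1) (j' := i) (by omega) (by omega) y' (fun m q h => by
        rw [hy']; exact isGammaValued_comp_gammaComplexι z m q h) (n - i)
      (fun m hm => hX m (by omega))
    choose p hp using fun q => exists_retraction (W := W) (I.X q)
    -- `h'` has values in `Γ_W(I)`, except possibly on `X^(n - i + 1)`. There it is projected to
    -- `Γ_W(I)`, which does not change its coboundary.
    let h' := y' - δ (i - 2) (i - 1) k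
    have hh' : δ (i - 1) i h' = z.comp (Cochain.ofHom (gammaComplexι W I)) (add_zero i) := by
      rw [← hy']
      simp [h', δ_δ]
    have hvp {A : ModuleCat.{u} R} {q : ℤ} {a : A ⟶ I.X q} (ha : IsGammaValued W a) :
        (a ≫ p q) ≫ gammaι W (I.X q) = a := by
      obtain ⟨b, rfl⟩ := ha
      rw [Category.assoc b, hp, Category.comp_id]
    let w : Cochain X (gammaComplex W I) (i - 1) := Cochain.mk fun m q h => h'.v m q h ≫ p q
    refine ⟨w, comp_gammaComplexι_injective ?_⟩
    rw [← δ_comp_ofHom, ← hh']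
    refine Cochain.ext _ _ fun m q h => ?_
    by_cases hq : n < q
    · exact (hI.isZero_above q hq).eq_of_tgt _ _
    have hwv (m q : ℤ) (h : m + (i - 1) = q) :
        (w.comp (Cochain.ofHom (gammaComplexι W I)) (add_zero (i - 1))).v m q h =
          (h'.v m q h ≫ p q) ≫ gammaι W (I.X q) := by
      rw [Cochain.comp_zero_cochain_v, Cochain.ofHom_v, Cochain.mk_v]
      rfl
    have h1 : IsGammaValued W (h'.v m (q - 1) (by omega)) := hk m (q - 1) (by omega) (by omega)
    have h2 : IsGammaValued W (X.d m (m + 1) ≫ h'.v (m + 1) q (by omega)) :=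
      isGammaValued_d_comp (j' := i) (by omega) (fun m q h => by
        rw [hh']; exact isGammaValued_comp_gammaComplexι z m q h) rfl (by omega)
        fun q h => hk m q h (by omega)
    rw [δ_v (i - 1) i (by omega) _ m q h (q - 1) (m + 1) rfl rfl,
      δ_v (i - 1) i (by omega) _ m q h (q - 1) (m + 1) rfl rfl, hwv, hwv, hvp h1,
      ← Category.assoc, ← Category.assoc, hvp h2]
  · intro z' hz'
    obtain ⟨k, hk⟩ := exists_isGammaValued_sub_δ (W := W) hinj d hd (j₀ := i - 1) (j' := i + 1)
      (by omega) rfl z' (fun m q h => by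
        rw [hz']; exact ⟨0, zero_comp⟩) (n - i) (fun m hm => hX m (by omega))
    obtain ⟨w, hw⟩ := exists_comp_gammaComplexι (W := W) (z' - δ (i - 1) i k) (fun m q h => by
      by_cases hq : n < q
      · exact .zero_of_isZero (hI.isZero_above q hq)
      · exact hk m q h (by omega))
    refine ⟨w, k, comp_gammaComplexι_injective ?_, by rw [hw, sub_sub_cancel]⟩
    rw [← δ_comp_ofHom, hw, Cochain.zero_comp]
    simp [hz', δ_δ]

end

/-! ### Derived Hom and K-injective complexes -/

section

open CochainComplex.HomComplex

/-- A morphism of short complexes of modules is a quasi-isomorphism if it is bijective on cycles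
modulo boundaries. -/
lemma quasiIso_of_bijective_on_cycles {S₁ S₂ : ShortComplex (ModuleCat.{u} R)} (φ : S₁ ⟶ S₂)
    (inj : ∀ x : S₁.X₂, S₁.g x = 0 → ∀ y, S₂.f y = φ.τ₂ x → ∃ w, S₁.f w = x)
    (surj : ∀ x' : S₂.X₂, S₂.g x' = 0 → ∃ x y, S₁.g x = 0 ∧ S₂.f y = x' - φ.τ₂ x) :
    ShortComplex.QuasiIso φ := by
  let h₁ := S₁.moduleCatLeftHomologyData
  let h₂ := S₂.moduleCatLeftHomologyData
  rw [ShortComplex.quasiIso_iff_isIso_leftHomologyMap' φ h₁ h₂,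
    ConcreteCategory.isIso_iff_bijective]
  have hπ (x : LinearMap.ker S₁.g.hom) : ShortComplex.leftHomologyMap' φ h₁ h₂
      (Submodule.Quotient.mk x) = h₂.π (ShortComplex.cyclesMap' φ h₁ h₂ x) :=
    congrArg (fun f => f.hom x) (ShortComplex.leftHomologyπ_naturality' φ h₁ h₂)
  have hi (x : LinearMap.ker S₁.g.hom) :
      (ShortComplex.cyclesMap' φ h₁ h₂ x : LinearMap.ker S₂.g.hom).1 = φ.τ₂ x.1 :=
    congrArg (fun f => f.hom x) (ShortComplex.cyclesMap'_i φ h₁ h₂)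
  constructor
  · refine (injective_iff_map_eq_zero (ShortComplex.leftHomologyMap' φ h₁ h₂).hom).2 fun x hx => ?_
    obtain ⟨x, rfl⟩ := Submodule.Quotient.mk_surjective _ x
    obtain ⟨y, hy⟩ := (Submodule.Quotient.mk_eq_zero _).1 ((hπ x).symm.trans hx)
    obtain ⟨w, hw⟩ := inj x.1 x.2 y ((congrArg Subtype.val hy).trans (hi x))
    exact (Submodule.Quotient.mk_eq_zero _).2 ⟨w, Subtype.ext hw⟩
  · intro x'
    obtain ⟨x', rfl⟩ := Submodule.Quotient.mk_surjective _ x'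
    obtain ⟨x, y, hx, hy⟩ := surj x'.1 x'.2
    refine ⟨Submodule.Quotient.mk ⟨x, hx⟩, (hπ _).trans (Eq.symm ?_)⟩
    refine (Submodule.Quotient.eq _).2 ⟨y, Subtype.ext (hy.trans ?_)⟩
    exact congrArg (x'.1 - ·) (hi ⟨x, hx⟩).symm

variable {X L L' : CochainComplex (ModuleCat.{u} R) ℤ}

lemma CohomologyBijective.quasiIsoAt {f : L ⟶ L'} {i : ℤ} (h : CohomologyBijective X f i) :
    QuasiIsoAt (homComplexMap X f) i := by
  rw [quasiIsoAt_iff' _ (i - 1) i (i + 1) (by simp) (by simp)]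
  exact quasiIso_of_bijective_on_cycles _ h.inj h.surj

lemma exists_δ_eq_iff {i : ℤ} (z : Cocycle X L i) : (∃ y, δ (i - 1) i y = z.1) ↔
    (HomotopyCategory.quotient _ _).map (Cocycle.equivHomShift.symm z) = 0 := by
  rw [← CohomologyClass.toHom_mk, CohomologyClass.toHom_mk_eq_zero_iff,
    mem_coboundaries_iff z (i - 1) (by omega)]

variable [HasDerivedCategory.{w} (ModuleCat.{u} R)]

lemma Q_map_eq_zero_iff [L.IsKInjective] (f : X ⟶ L) :
    DerivedCategory.Q.map f = 0 ↔ (HomotopyCategory.quotient _ _).map f = 0 := by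
  have h := DerivedCategory.quotientCompQhIso_hom_naturality f
  constructor
  · intro h0
    refine (CochainComplex.IsKInjective.Qh_map_bijective _ L).1 ?_
    rw [h0, comp_zero] at h
    rw [Functor.map_zero]
    exact (cancel_mono ((DerivedCategory.quotientCompQhIso (ModuleCat.{u} R)).hom.app L)).1
      (h.trans zero_comp.symm)
  · intro h0
    rw [h0, Functor.map_zero, zero_comp] at h
    exact (cancel_epi ((DerivedCategory.quotientCompQhIso (ModuleCat.{u} R)).hom.app X)).1
      (h.symm.trans comp_zero.symm)

lemma Q_map_surjective [L.IsKInjective] (φ : DerivedCategory.Q.obj X ⟶ DerivedCategory.Q.obj L) :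
    ∃ f : X ⟶ L, DerivedCategory.Q.map f = φ := by
  obtain ⟨g, hg⟩ := (CochainComplex.IsKInjective.Qh_map_bijective _ L).2
    ((DerivedCategory.quotientCompQhIso (ModuleCat.{u} R)).hom.app X ≫ φ ≫
      (DerivedCategory.quotientCompQhIso (ModuleCat.{u} R)).inv.app L)
  obtain ⟨f, rfl⟩ := (HomotopyCategory.quotient _ _).map_surjective g
  refine ⟨f, (cancel_epi ((DerivedCategory.quotientCompQhIso (ModuleCat.{u} R)).hom.app X)).1 ?_⟩
  rw [← DerivedCategory.quotientCompQhIso_hom_naturality, hg]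
  simp

/-- The morphism `X ⟶ L[i]` of the derived category defined by a cocycle of `Hom•(X, L)`. -/
def cocycleToDExt {i : ℤ} (z : Cocycle X L i) :
    DExt (DerivedCategory.Q.obj X) (DerivedCategory.Q.obj L) i :=
  DerivedCategory.Q.map (Cocycle.equivHomShift.symm z) ≫
    (DerivedCategory.Q.commShiftIso i).hom.app L

lemma cocycleToDExt_sub {i : ℤ} (z z' : Cocycle X L i) :
    cocycleToDExt (z - z') = cocycleToDExt z - cocycleToDExt z' := by
  rw [cocycleToDExt, map_sub, Functor.map_sub, Preadditive.sub_comp]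
  rfl

lemma cocycleToDExt_eq_zero_iff [L.IsKInjective] {i : ℤ} (z : Cocycle X L i) :
    cocycleToDExt z = 0 ↔ ∃ y, δ (i - 1) i y = z.1 := by
  rw [exists_δ_eq_iff, ← Q_map_eq_zero_iff]
  exact ⟨fun h => (cancel_mono ((DerivedCategory.Q.commShiftIso i).hom.app L)).1
    (h.trans zero_comp.symm), fun h => by rw [cocycleToDExt, h, zero_comp]⟩

lemma cocycleToDExt_surjective [L.IsKInjective] {i : ℤ}
    (φ : DExt (DerivedCategory.Q.obj X) (DerivedCategory.Q.obj L) i) :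
    ∃ z : Cocycle X L i, cocycleToDExt z = φ := by
  obtain ⟨f, hf⟩ := Q_map_surjective (φ ≫ (DerivedCategory.Q.commShiftIso i).inv.app L)
  refine ⟨Cocycle.equivHomShift f, ?_⟩
  rw [cocycleToDExt, AddEquiv.symm_apply_apply, hf, Category.assoc, Iso.inv_hom_id_app]
  exact Category.comp_id _

lemma extMap_cocycleToDExt {i : ℤ} (z : Cocycle X L i) (f : L ⟶ L') :
    extMap _ (DerivedCategory.Q.map f) i (cocycleToDExt z) = cocycleToDExt (z.postcomp f) := by
  change cocycleToDExt z ≫ _ = _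
  rw [cocycleToDExt, cocycleToDExt, Cocycle.equivHomShift_symm_postcomp, Functor.map_comp,
    Category.assoc, Category.assoc]
  exact congrArg _ ((DerivedCategory.Q.commShiftIso i).hom.naturality f).symm

/-- For K-injective complexes `L` and `L'`, the map on `Extⁱ(X, -)` is the map on
`Hⁱ(Hom•(X, -))`. -/
theorem bijective_extMap_iff [L.IsKInjective] [L'.IsKInjective] (f : L ⟶ L') (i : ℤ) :
    Function.Bijective (extMap (DerivedCategory.Q.obj X) (DerivedCategory.Q.map f) i) ↔
      CohomologyBijective X f i := by
  constructor
  · rintro ⟨h1, h2⟩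
    constructor
    · intro z hz y' hy'
      refine (cocycleToDExt_eq_zero_iff (Cocycle.mk z _ rfl hz)).1 (h1 ?_)
      rw [extMap_cocycleToDExt, map_zero]
      exact (cocycleToDExt_eq_zero_iff _).2 ⟨y', hy'⟩
    · intro z' hz'
      obtain ⟨φ, hφ⟩ := h2 (cocycleToDExt (Cocycle.mk z' _ rfl hz'))
      obtain ⟨z, rfl⟩ := cocycleToDExt_surjective φ
      rw [extMap_cocycleToDExt, eq_comm, ← sub_eq_zero, ← cocycleToDExt_sub,
        cocycleToDExt_eq_zero_iff] at hφ
      obtain ⟨y', hy'⟩ := hφ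
      exact ⟨z.1, y', z.δ_eq_zero _, hy'⟩
  · intro h
    constructor
    · refine (injective_iff_map_eq_zero _).2 fun φ hφ => ?_
      obtain ⟨z, rfl⟩ := cocycleToDExt_surjective φ
      rw [extMap_cocycleToDExt, cocycleToDExt_eq_zero_iff] at hφ
      obtain ⟨y', hy'⟩ := hφ
      exact (cocycleToDExt_eq_zero_iff _).2 (h.inj z.1 (z.δ_eq_zero _) y' hy')
    · intro φ
      obtain ⟨z', rfl⟩ := cocycleToDExt_surjective φ
      obtain ⟨z, y', hz, hy'⟩ := h.surj z'.1 (z'.δ_eq_zero _)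
      refine ⟨cocycleToDExt (Cocycle.mk z _ rfl hz), ?_⟩
      rw [extMap_cocycleToDExt, eq_comm, ← sub_eq_zero, ← cocycleToDExt_sub,
        cocycleToDExt_eq_zero_iff]
      exact ⟨y', hy'⟩

end

/-! ### The torsion subcomplex and the right adjoint -/

section

lemma IsBoundedInjective.isKInjective {I : CochainComplex (ModuleCat.{u} R) ℤ} {n : ℤ}
    (hI : IsBoundedInjective I n) : I.IsKInjective := by
  obtain ⟨d, hd⟩ := hI.isZero_below
  have := hI.injective
  have : I.IsStrictlyGE d := (CochainComplex.isStrictlyGE_iff _ _).2 hd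
  exact CochainComplex.isKInjective_of_injective I d

section

variable {W : Set (PrimeSpectrum R)} {I : CochainComplex (ModuleCat.{u} R) ℤ}

lemma isBoundedInjective_gammaComplex [IsNoetherianRing R] {n : ℤ} (hI : IsBoundedInjective I n) :
    IsBoundedInjective (gammaComplex W I) n where
  injective i := by
    have := hI.injective i
    exact inferInstanceAs (Injective ((gammaFunctor W).obj (I.X i)))
  isZero_below := hI.isZero_below.imp fun _ h i hi => (gammaFunctor W).map_isZero (h i hi)
  isZero_above i hi := (gammaFunctor W).map_isZero (hI.isZero_above i hi)

lemma support_homology_gammaComplex (i : ℤ) :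
    Module.support R ((gammaComplex W I).homology i) ⊆ W := by
  intro p hp
  by_contra hpW
  refine (Module.notMem_support_iff' (p := p)).2 ?_ hp
  refine (isZero_locFunctor_iff p.asIdeal.primeCompl _).1
    ((isZero_locFunctor_homology_iff _ (gammaComplex W I) (i - 1) i (i + 1) (by omega) rfl).2 ?_)
  intro z _
  obtain ⟨s, hs, h⟩ := mem_gammaSubmodule_iff.1
    (Subtype.property (p := (· ∈ gammaSubmodule W (I.X i))) z) p hpW
  exact ⟨s, hs, 0, (map_zero _).trans (Subtype.ext h.symm)⟩

end

/-- The cohomology of `σ_{≤ -1} X` is that of `X` in negative degrees, and zero elsewhere. -/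
lemma support_homology_truncLE_iff (W : Set (PrimeSpectrum R))
    (X : CochainComplex (ModuleCat.{u} R) ℤ) :
    (∀ i, Module.support R ((X.truncLE (-1)).homology i) ⊆ W) ↔ NegCohomologySupportedIn X W := by
  have h {i : ℤ} (hi : i < 0) : Module.support R ((X.truncLE (-1)).homology i) =
      Module.support R (X.homology i) := by
    have := X.quasiIsoAt_ιTruncLE (-1) i (by omega)
    exact (asIso (HomologicalComplex.homologyMap (X.ιTruncLE (-1)) i)).toLinearEquiv.support_eq
  constructor
  · intro hX i hi
    rw [← h hi]
    exact hX i
  · intro hX i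
    by_cases hi : i < 0
    · rw [h hi]
      exact hX i hi
    · have := ModuleCat.subsingleton_of_isZero
        ((X.truncLE (-1)).isZero_of_isLE (-1) i (by omega))
      rw [Module.support_eq_empty]
      exact Set.empty_subset _

variable [HasDerivedCategory.{w} (ModuleCat.{u} R)]

lemma bijective_extMap_zero_iff (X : DerivedCategory (ModuleCat.{u} R))
    {Y Z : DerivedCategory (ModuleCat.{u} R)} (φ : Y ⟶ Z) :
    Function.Bijective (extMap X φ 0) ↔ Function.Bijective (fun f : X ⟶ Y => f ≫ φ) := by
  let eY := (Iso.refl X).homCongr ((shiftFunctorZero (DerivedCategory (ModuleCat.{u} R)) ℤ).app Y)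
  let eZ := (Iso.refl X).homCongr ((shiftFunctorZero (DerivedCategory (ModuleCat.{u} R)) ℤ).app Z)
  have : (fun f : X ⟶ Y => f ≫ φ) ∘ eY = eZ ∘ extMap X φ 0 := by
    funext f
    change (𝟙 X ≫ f ≫ _) ≫ φ = 𝟙 X ≫ (f ≫ _) ≫ _
    simp
  rw [← Function.Bijective.of_comp_iff _ eY.bijective, this,
    Function.Bijective.of_comp_iff' eZ.bijective]

lemma bijective_comp_of_iso {X X' Y Z : DerivedCategory (ModuleCat.{u} R)} (e : X ≅ X') {φ : Y ⟶ Z}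
    (h : Function.Bijective (fun f : X ⟶ Y => f ≫ φ)) :
    Function.Bijective (fun f : X' ⟶ Y => f ≫ φ) := by
  have : (fun f : X' ⟶ Y => f ≫ φ) ∘ (Iso.homCongr e (Iso.refl Y)) =
      (Iso.homCongr e (Iso.refl Z)) ∘ (fun f : X ⟶ Y => f ≫ φ) := by
    funext f
    simp
  rw [← Function.Bijective.of_comp_iff _ (Iso.homCongr e (Iso.refl Y)).bijective, this,
    Function.Bijective.of_comp_iff' (Iso.homCongr e (Iso.refl Z)).bijective]
  exact h

lemma extMap_bijective_of_iso (X : DerivedCategory (ModuleCat.{u} R))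
    {Y Z Y' Z' : DerivedCategory (ModuleCat.{u} R)} {φ : Y ⟶ Z} {φ' : Y' ⟶ Z'} (e : Y ≅ Y')
    (e' : Z ≅ Z') (h : φ ≫ e'.hom = e.hom ≫ φ') (i : ℤ) :
    Function.Bijective (extMap X φ i) ↔ Function.Bijective (extMap X φ' i) := by
  let F := shiftFunctor (DerivedCategory (ModuleCat.{u} R)) i
  let eY := (Iso.refl X).homCongr (F.mapIso e)
  let eZ := (Iso.refl X).homCongr (F.mapIso e')
  have : extMap X φ' i ∘ eY = eZ ∘ extMap X φ i := by
    funext f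
    change (𝟙 X ≫ f ≫ F.map e.hom) ≫ F.map φ' = 𝟙 X ≫ (f ≫ F.map φ) ≫ F.map e'.hom
    simp only [Category.id_comp, Category.assoc, ← F.map_comp, h]
  rw [← Function.Bijective.of_comp_iff _ eY.bijective, this,
    Function.Bijective.of_comp_iff' eZ.bijective]

lemma inducesIsoTruncRHom_of_bijective_extMap (X : CochainComplex (ModuleCat.{u} R) ℤ)
    {Y Z : DerivedCategory (ModuleCat.{u} R)} (φ : Y ⟶ Z) (n : ℤ)
    (h₀ : ∃ (J : KInjectiveResolution Y) (J' : KInjectiveResolution Z)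
      (f : J.complex ⟶ J'.complex), DerivedCategory.Q.map f ≫ J'.iso.hom = J.iso.hom ≫ φ)
    (h : ∀ i > n, Function.Bijective (extMap (DerivedCategory.Q.obj X) φ i)) :
    InducesIsoTruncRHom X φ n where
  exists_lift := h₀
  isIso J J' f hf := by
    have := J.isKInjective
    have := J'.isKInjective
    rw [DerivedCategory.isIso_Q_map_iff_quasiIso, CochainComplex.quasiIso_truncGEMap_iff]
    intro i hi
    exact ((bijective_extMap_iff f i).1
      ((extMap_bijective_of_iso _ J.iso J'.iso hf i).2 (h i (by omega)))).quasiIsoAt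

variable [IsNoetherianRing R] {W : Set (PrimeSpectrum R)}
  {X I : CochainComplex (ModuleCat.{u} R) ℤ} {n : ℤ}

theorem bijective_extMap_gammaComplexι (hI : IsBoundedInjective I n) (i : ℤ)
    (hX : ∀ m, m + i ≤ n → Module.support R (X.homology m) ⊆ W) :
    Function.Bijective (extMap (DerivedCategory.Q.obj X)
      (DerivedCategory.Q.map (gammaComplexι W I)) i) := by
  have := hI.isKInjective
  have := (isBoundedInjective_gammaComplex (W := W) hI).isKInjective
  exact (bijective_extMap_iff _ _).2 (cohomologyBijective_gammaComplexι hI i hX)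

/-- The morphism `Γ_W(I) ⟶ I` is final among the morphisms from objects of `L_W` to `I`. -/
lemma bijective_comp_gammaComplexι (hW : StableUnderSpecialization W) (hI : IsBoundedInjective I n)
    {Y : DerivedCategory (ModuleCat.{u} R)} (hY : subcategoryOfSupport W Y) :
    Function.Bijective (fun f : Y ⟶ _ => f ≫ DerivedCategory.Q.map (gammaComplexι W I)) := by
  have e := DerivedCategory.Q.objObjPreimageIso Y
  refine bijective_comp_of_iso e ((bijective_extMap_zero_iff _ _).1
    (bijective_extMap_gammaComplexι hI 0 fun m _ => ?_))
  rw [subcategoryOfSupport_iff hW] at hY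
  have := LinearEquiv.support_eq (((DerivedCategory.homologyFunctorFactors _ m).app _).symm ≪≫
    (DerivedCategory.homologyFunctor _ m).mapIso e).toLinearEquiv
  exact this.trans_subset (hY m)

/-- A right adjoint of the inclusion of `L_W` sends `I` to `Γ_W(I)`, since the counit is also
final among the morphisms from objects of `L_W` to `I`. -/
lemma exists_iso_gamma (hW : StableUnderSpecialization W) (hI : IsBoundedInjective I n)
    (γ : DerivedCategory (ModuleCat.{u} R) ⥤ (subcategoryOfSupport W).FullSubcategory)
    (adj : (subcategoryOfSupport W).ι ⊣ γ) :
    ∃ e : DerivedCategory.Q.obj (gammaComplex W I) ≅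
        (subcategoryOfSupport W).ι.obj (γ.obj (DerivedCategory.Q.obj I)),
      e.hom ≫ adj.counit.app (DerivedCategory.Q.obj I) =
        DerivedCategory.Q.map (gammaComplexι W I) := by
  let c := adj.counit.app (DerivedCategory.Q.obj I)
  let ι := DerivedCategory.Q.map (gammaComplexι W I)
  let G : (subcategoryOfSupport W).FullSubcategory := γ.obj (DerivedCategory.Q.obj I)
  have hΓ : subcategoryOfSupport W (DerivedCategory.Q.obj (gammaComplex W I)) :=
    (subcategoryOfSupport_Q_iff hW _).2 support_homology_gammaComplex
  -- both `c` and `ι` are final among morphisms from objects of `L_W` to `I`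
  have hc (Y : (subcategoryOfSupport W).FullSubcategory) :
      Function.Bijective (fun f : Y.obj ⟶ G.obj => f ≫ c) := by
    have := (((subcategoryOfSupport W).fullyFaithfulι.homEquiv (X := Y) (Y := G)).symm.trans
      (adj.homEquiv Y (DerivedCategory.Q.obj I)).symm).bijective
    refine (congrArg Function.Bijective ?_).mp this
    funext f
    exact adj.homEquiv_counit _ _ _
  have hι (Y : (subcategoryOfSupport W).FullSubcategory) :=
    bijective_comp_gammaComplexι hW hI Y.property
  obtain ⟨a, ha⟩ := (hc ⟨_, hΓ⟩).2 ι
  obtain ⟨b, hb⟩ := (hι G).2 c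
  dsimp only at ha hb
  refine ⟨⟨a, b, (hι ⟨_, hΓ⟩).1 ?_, (hc G).1 ?_⟩, ha⟩
  · change (a ≫ b) ≫ ι = 𝟙 _ ≫ ι
    rw [Category.assoc, Category.id_comp]
    exact (congrArg (a ≫ ·) hb).trans ha
  · change (b ≫ a) ≫ c = 𝟙 _ ≫ c
    rw [Category.assoc, Category.id_comp]
    exact (congrArg (b ≫ ·) ha).trans hb

end

end ARPrinciple

end

theorem theorem2p3 {R : Type u} [CommRing R] [IsNoetherianRing R]
    [HasDerivedCategory.{w} (ModuleCat.{u} R)] :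
    -- the principle for a smashing subcategory and a right adjoint `γ` of its inclusion
    (∀ (L : ObjectProperty (DerivedCategory (ModuleCat.{u} R))), ARPrinciple.IsSmashing L →
      ∀ (γ : DerivedCategory (ModuleCat.{u} R) ⥤ L.FullSubcategory) (adj : L.ι ⊣ γ)
        (X I : CochainComplex (ModuleCat.{u} R) ℤ) (n : ℤ),
        ARPrinciple.IsBoundedInjective I n →
        L (DerivedCategory.Q.obj (X.truncLE (-1))) →
          ARPrinciple.InducesIsoTruncRHom X (adj.counit.app (DerivedCategory.Q.obj I)) n ∧
          ∀ i > n, Function.Bijective (ARPrinciple.extMap (DerivedCategory.Q.obj X)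
            (adj.counit.app (DerivedCategory.Q.obj I)) i)) ∧
    -- the description of the hypothesis, of `γ` and of the conclusion when `L = L_W`
    (∀ (W : Set (PrimeSpectrum R)), StableUnderSpecialization W →
      (∀ X : CochainComplex (ModuleCat.{u} R) ℤ,
        ARPrinciple.subcategoryOfSupport W (DerivedCategory.Q.obj (X.truncLE (-1))) ↔
          ARPrinciple.NegCohomologySupportedIn X W) ∧
      (∀ (γ : DerivedCategory (ModuleCat.{u} R) ⥤
            (ARPrinciple.subcategoryOfSupport W).FullSubcategory)
        (adj : (ARPrinciple.subcategoryOfSupport W).ι ⊣ γ)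
        (I : CochainComplex (ModuleCat.{u} R) ℤ) (n : ℤ),
        ARPrinciple.IsBoundedInjective I n →
          ∃ e : DerivedCategory.Q.obj (ARPrinciple.gammaComplex W I) ≅
              (ARPrinciple.subcategoryOfSupport W).ι.obj (γ.obj (DerivedCategory.Q.obj I)),
            e.hom ≫ adj.counit.app (DerivedCategory.Q.obj I) =
              DerivedCategory.Q.map (ARPrinciple.gammaComplexι W I)) ∧
      (∀ (X I : CochainComplex (ModuleCat.{u} R) ℤ) (n : ℤ),
        ARPrinciple.IsBoundedInjective I n →
        ARPrinciple.NegCohomologySupportedIn X W →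
          ∀ i > n, Function.Bijective (ARPrinciple.extMap (DerivedCategory.Q.obj X)
            (DerivedCategory.Q.map (ARPrinciple.gammaComplexι W I)) i))) := by
  have trunc (W : Set (PrimeSpectrum R)) (hW : StableUnderSpecialization W)
      (X : CochainComplex (ModuleCat.{u} R) ℤ) :
      ARPrinciple.subcategoryOfSupport W (DerivedCategory.Q.obj (X.truncLE (-1))) ↔
        ARPrinciple.NegCohomologySupportedIn X W :=
    (ARPrinciple.subcategoryOfSupport_Q_iff hW _).trans
      (ARPrinciple.support_homology_truncLE_iff W X)
  refine ⟨?_, fun W hW => ⟨trunc W hW, fun γ adj I n hI => ARPrinciple.exists_iso_gamma hW hI γ adj,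
    fun X I n hI hX i hi => ARPrinciple.bijective_extMap_gammaComplexι hI i
      fun m hm => hX m (by omega)⟩⟩
  rintro L ⟨W, hW, rfl⟩ γ adj X I n hI hX
  obtain ⟨e, he⟩ := ARPrinciple.exists_iso_gamma hW hI γ adj
  have hbij : ∀ i > n, Function.Bijective (ARPrinciple.extMap (DerivedCategory.Q.obj X)
      (adj.counit.app (DerivedCategory.Q.obj I)) i) := fun i hi =>
    (ARPrinciple.extMap_bijective_of_iso _ e (Iso.refl _) (by simp [he]) i).1
      (ARPrinciple.bijective_extMap_gammaComplexι hI i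
        fun m hm => (trunc W hW X).1 hX m (by omega))
  refine ⟨ARPrinciple.inducesIsoTruncRHom_of_bijective_extMap X _ n ?_ hbij, hbij⟩
  exact ⟨⟨_, (ARPrinciple.isBoundedInjective_gammaComplex hI).isKInjective, e⟩,
    ⟨_, hI.isKInjective, Iso.refl _⟩, ARPrinciple.gammaComplexι W I, by simp [he]⟩
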